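/- Let $\mathbb B$ be Bargmann space: the entire functions $\varphi$ with $\frac1\pi\int_{\mathbb C}|\varphi(z)|^2e^{-|z|^2}\,dx\,dy<\infty$, with the corresponding inner product and the orthonormal basis $e_k(z)=z^k/\sqrt{k!}$, $k\ge 0$. Let $a\varphi=\varphi'$ and $a^*\varphi(z)=z\varphi(z)$. For integers $p\ge 0$ and $m\ge 1$ consider the generalized Heun expression $$H^{p,m}=a^{*p}\,(a^m+a^{*m})\,a^p .$$ Let $\mathbb B_p=\{\varphi\in\mathbb B:\varphi(0)=\dots=\varphi^{(p-1)}(0)=0\}$, which has the orthonormal basis $e_p,e_{p+1},\dots$, and let $\mathbb H$ be the minimal operator generated by $H^{p,m}$ in $\mathbb B_p$, that is, the closure of $H^{p,m}$ restricted to the polynomials in $\mathbb B_p$. Suppose that $p+\frac m2>1$. Then: 1. $\mathbb H$ is a densely defined closed symmetric operator, and it is completely indeterminate: its deficiency numbers are $n_+=n_-=m$, that is, $\dim\big((\mathbb H-zI)D(\mathbb H)\big)^{\perp}=m$ for every $z$ with $\operatorname{Im}z>0$ and for every $z$ with $\operatorname{Im}z<0$. The same holds for the closure in $\mathbb B$ of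 $H^{p,m}$ restricted to all polynomials. 2. For $i\ge 1$ let $B_i$ be the diagonal $m\times m$ matrix with diagonal entries $$\beta_k=\frac{\sqrt{k!\,(k+m)!}}{(k-p)!},\qquad p+(i-1)m\le k\le p+im-1 .$$ The unitary map from $\mathbb B_p$ onto $\ell^2(\mathbb N;\mathbb C^m)$ that cuts the basis $e_p,e_{p+1},\dots$ into consecutive blocks of length $m$ carries $\mathbb H$ to the minimal block Jacobi operator with diagonal blocks $0$ and off-diagonal blocks $B_i$, that is, to the closure of $$(J\phi)_i=B_{i-1}^*\phi_{i-1}+B_i\phi_{i+1}\quad(i\ge 1,\ \phi_0=0)$$ on the finitely supported sequences. 3. In the spectral norm, $\|B_i\|\sim (im)^{p+\frac m2}$ as $i\to\infty$ (the quotient tends to $1$); in particular $\|B_i\|$ grows like $i^{p+\frac m2}$. -/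

import Mathlib

open MeasureTheory Filter Asymptotics
open scoped Topology Matrix ComplexConjugate InnerProductSpace LinearPMap

noncomputable section

/-! ## Entire functions and the annihilation, creation and Heun operators -/

/-- The space of entire functions. -/
def entire : Submodule ℂ (ℂ → ℂ) where
  carrier := {f | Differentiable ℂ f}
  add_mem' hf hg := Differentiable.add hf hg
  zero_mem' := differentiable_const 0
  smul_mem' c _ hf := Differentiable.const_smul hf c

/-- The annihilation operator `f ↦ f'`. -/
def annihilation : entire →ₗ[ℂ] entire where
  toFun f := ⟨deriv f.1, Differentiable.deriv f.2⟩
  map_add' f g := Subtype.ext (funext fun z => deriv_add (f.2 z) (g.2 z))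
  map_smul' c f := Subtype.ext (funext fun z => deriv_const_smul c (f.2 z))

/-- The creation operator `f ↦ z f`. -/
def creation : entire →ₗ[ℂ] entire where
  toFun f := ⟨fun z => z * f.1 z, Differentiable.mul differentiable_id f.2⟩
  map_add' f g := Subtype.ext (funext fun z => mul_add z (f.1 z) (g.1 z))
  map_smul' c f := Subtype.ext (funext fun z => mul_left_comm z c (f.1 z))

/-- The generalized Heun expression `a*^p (a^m + a*^m) a^p` on entire functions. -/
def heunExpr (p m : ℕ) : Module.End ℂ entire :=
  creation ^ p * (annihilation ^ m + creation ^ m) * annihilation ^ p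

/-! ## Bargmann space -/

/-- The Gaussian measure `π⁻¹ exp(-|z|²) dx dy`; with the factor `π⁻¹` the functions
`z ^ k / √(k!)` have norm one. -/
def gaussMeasure : Measure ℂ :=
  volume.withDensity fun z => ENNReal.ofReal (Real.exp (-‖z‖ ^ 2) / Real.pi)

/-- The entire functions that are square integrable for the Gaussian measure. -/
def bargmannSubmodule : Submodule ℂ entire where
  carrier := {f | MemLp f.1 2 gaussMeasure}
  add_mem' hf hg := MemLp.add hf hg
  zero_mem' := MemLp.zero
  smul_mem' c _ hf := MemLp.const_smul hf c

/-- Bargmann space. A type of its own, so that it carries the `L²` norm only. -/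
def Bargmann : Type := bargmannSubmodule

namespace Bargmann

instance : AddCommGroup Bargmann := inferInstanceAs (AddCommGroup bargmannSubmodule)
instance : Module ℂ Bargmann := inferInstanceAs (Module ℂ bargmannSubmodule)

/-- The inclusion of Bargmann space in the space of entire functions. -/
def toEntire : Bargmann →ₗ[ℂ] entire := bargmannSubmodule.subtype

instance : CoeFun Bargmann (fun _ => ℂ → ℂ) := ⟨fun φ => (toEntire φ).1⟩

theorem toEntire_injective : Function.Injective toEntire := Subtype.val_injective

/-- The inclusion of Bargmann space in `L²` of the Gaussian measure. -/
def toL2 : Bargmann →ₗ[ℂ] Lp ℂ 2 gaussMeasure where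
  toFun φ := MemLp.toLp (φ : ℂ → ℂ) φ.2
  map_add' φ ψ := MemLp.toLp_add φ.2 ψ.2
  map_smul' c φ := MemLp.toLp_const_smul c φ.2

theorem toL2_injective : Function.Injective toL2 := by
  intro φ ψ h
  have h1 : (φ : ℂ → ℂ) =ᵐ[gaussMeasure] ψ := (MemLp.toLp_eq_toLp_iff φ.2 ψ.2).1 h
  have h2 : (volume : Measure ℂ) ≪ gaussMeasure := by
    refine withDensity_absolutelyContinuous' (by fun_prop) (Eventually.of_forall fun z => ?_)
    simp only [ne_eq, ENNReal.ofReal_eq_zero, not_le]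
    positivity
  have h3 : (φ : ℂ → ℂ) =ᵐ[volume] ψ := h2.ae_le h1
  have h4 : (φ : ℂ → ℂ) = ψ :=
    (Continuous.ae_eq_iff_eq volume (toEntire φ).2.continuous (toEntire ψ).2.continuous).1 h3
  exact toEntire_injective (Subtype.ext h4)

instance : NormedAddCommGroup Bargmann :=
  NormedAddCommGroup.induced Bargmann (Lp ℂ 2 gaussMeasure) toL2 toL2_injective

instance : InnerProductSpace ℂ Bargmann where
  norm_smul_le c φ := by
    change ‖toL2 (c • φ)‖ ≤ ‖c‖ * ‖toL2 φ‖
    rw [map_smul]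
    exact norm_smul_le c (toL2 φ)
  inner φ ψ := ⟪toL2 φ, toL2 ψ⟫_ℂ
  norm_sq_eq_re_inner φ := norm_sq_eq_re_inner (toL2 φ)
  conj_inner_symm φ ψ := inner_conj_symm (toL2 φ) (toL2 ψ)
  add_left φ ψ χ := by rw [map_add, inner_add_left]
  smul_left φ ψ c := by rw [map_smul, inner_smul_left]

/-- The inner product is the Gaussian integral (conjugate linear in the first variable). -/
theorem inner_eq_integral (φ ψ : Bargmann) :
    ⟪φ, ψ⟫_ℂ = ∫ z, conj (φ z) * ψ z ∂gaussMeasure := by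
  change ⟪toL2 φ, toL2 ψ⟫_ℂ = _
  rw [L2.inner_def]
  refine integral_congr_ae ?_
  filter_upwards [MemLp.coeFn_toLp φ.2, MemLp.coeFn_toLp ψ.2] with z h1 h2
  have h1' : (toL2 φ : ℂ → ℂ) z = φ z := h1
  have h2' : (toL2 ψ : ℂ → ℂ) z = ψ z := h2
  rw [h1', h2', RCLike.inner_apply, mul_comm]

end Bargmann

/-- The functions `e_k(z) = z ^ k / √(k!)`. -/
def bargmannBasisFun (k : ℕ) : ℂ → ℂ := fun z => z ^ k / (Real.sqrt (Nat.factorial k : ℝ) : ℂ)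

/-- The linear span of the `e_k` in Bargmann space (the polynomials). -/
def bargmannPolynomials : Submodule ℂ Bargmann :=
  Submodule.span ℂ {φ | ∃ k : ℕ, (φ : ℂ → ℂ) = bargmannBasisFun k}

/-- The subspace of functions in Bargmann space whose derivatives of order less than `p` vanish
at the origin. -/
def bargmannVanishing (p : ℕ) : Submodule ℂ Bargmann where
  carrier := {φ | ∀ j < p, ((annihilation ^ j) (Bargmann.toEntire φ)).1 0 = 0}
  add_mem' {φ ψ} hφ hψ j hj := by simp [hφ j hj, hψ j hj]
  zero_mem' j _ := by simp
  smul_mem' c φ hφ j hj := by simp [hφ j hj]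

/-! ## Unbounded operators and their deficiency numbers -/

/-- The part of an unbounded operator `T` in a subspace `V`: its domain consists of the
`v ∈ V ∩ D(T)` with `T v ∈ V`. -/
def partOn {E : Type*} [AddCommGroup E] [Module ℂ E] (T : E →ₗ.[ℂ] E) (V : Submodule ℂ E) :
    V →ₗ.[ℂ] V where
  domain :=
    { carrier := {v | ∃ h : (v : E) ∈ T.domain, T ⟨v, h⟩ ∈ V}
      add_mem' := by
        rintro v w ⟨hv, hv'⟩ ⟨hw, hw'⟩
        refine ⟨T.domain.add_mem hv hw, ?_⟩
        have := V.add_mem hv' hw'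
        rwa [← LinearPMap.map_add] at this
      zero_mem' := ⟨T.domain.zero_mem, by
        have := V.zero_mem
        rwa [← LinearPMap.map_zero T] at this⟩
      smul_mem' := by
        rintro c v ⟨hv, hv'⟩
        refine ⟨T.domain.smul_mem c hv, ?_⟩
        have := V.smul_mem c hv'
        rwa [← LinearPMap.map_smul] at this }
  toFun :=
    { toFun := fun v => ⟨T ⟨v.1, v.2.1⟩, v.2.2⟩
      map_add' := fun v w => Subtype.ext (T.map_add ⟨v.1, v.2.1⟩ ⟨w.1, w.2.1⟩)
      map_smul' := fun c v => Subtype.ext (T.map_smul c ⟨v.1, v.2.1⟩) }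

/-- The deficiency number of `T` at `z`: the dimension of the orthogonal complement of
`(T - z) D(T)`. For a densely defined operator in a Hilbert space that complement is the
eigenspace of the adjoint of `T` for the eigenvalue `conj z`. -/
def deficiencyNumber {E : Type*} [NormedAddCommGroup E] [InnerProductSpace ℂ E]
    (T : E →ₗ.[ℂ] E) (z : ℂ) : Cardinal :=
  Module.rank ℂ (LinearMap.range (T.toFun - z • T.domain.subtype))ᗮ

/-- `T` has deficiency numbers `n₊ = n₋ = m`: the deficiency number is `m` at every point of the
upper half-plane and at every point of the lower half-plane. -/
def IsCompletelyIndeterminate {E : Type*} [NormedAddCommGroup E] [InnerProductSpace ℂ E]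
    (m : ℕ) (T : E →ₗ.[ℂ] E) : Prop :=
  (∀ z : ℂ, 0 < z.im → deficiencyNumber T z = m) ∧
    (∀ z : ℂ, z.im < 0 → deficiencyNumber T z = m)

/-- `T` is a densely defined closed symmetric operator. -/
def IsClosedSymmetric {E : Type*} [NormedAddCommGroup E] [InnerProductSpace ℂ E]
    (T : E →ₗ.[ℂ] E) : Prop :=
  Dense (T.domain : Set E) ∧ T.IsClosed ∧ T.IsFormalAdjoint T

/-! ## The generalized Heun operator in Bargmann space -/

/-- The Heun operator with its maximal domain: the `φ` in Bargmann space for which the Heun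
expression of `φ` is again in Bargmann space. -/
def heunMax (p m : ℕ) : Bargmann →ₗ.[ℂ] Bargmann where
  domain := (LinearMap.range Bargmann.toEntire).comap (heunExpr p m ∘ₗ Bargmann.toEntire)
  toFun :=
    (LinearEquiv.ofInjective Bargmann.toEntire Bargmann.toEntire_injective).symm.toLinearMap ∘ₗ
      (heunExpr p m ∘ₗ Bargmann.toEntire).restrict (fun _ h => h)

/-- The Heun operator on the polynomials. -/
def heunPoly (p m : ℕ) : Bargmann →ₗ.[ℂ] Bargmann :=
  (heunMax p m).domRestrict bargmannPolynomials

/-- The minimal Heun operator in the whole Bargmann space: the closure of the operator on the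
polynomials. -/
def heunMinFull (p m : ℕ) : Bargmann →ₗ.[ℂ] Bargmann := (heunPoly p m).closure

/-- The minimal Heun operator in the subspace spanned by `e_p, e_{p+1}, …`: the closure of the
operator on the polynomials in that subspace. -/
def heunMin (p m : ℕ) : bargmannVanishing p →ₗ.[ℂ] bargmannVanishing p :=
  (partOn (heunPoly p m) (bargmannVanishing p)).closure

/-! ## Block Jacobi matrices -/

/-- The space of square summable sequences of vectors of `ℂ^m`. -/
abbrev BlockSeq (m : ℕ) : Type := lp (fun _ : ℕ => EuclideanSpace ℂ (Fin m)) 2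

/-- The block Jacobi expression with diagonal blocks `A i` and off-diagonal blocks `B i`:
`(J φ)_i = (B (i-1))ᴴ φ_{i-1} + A i φ_i + B i φ_{i+1}`, without the first term for `i = 0`. -/
def jacobiExpr {m : ℕ} (A B : ℕ → Matrix (Fin m) (Fin m) ℂ) :
    (ℕ → EuclideanSpace ℂ (Fin m)) →ₗ[ℂ] (ℕ → EuclideanSpace ℂ (Fin m)) :=
  LinearMap.pi fun i =>
    (match i with
      | 0 => 0
      | n + 1 => (B n)ᴴ.toEuclideanLin ∘ₗ LinearMap.proj n) +
    (A i).toEuclideanLin ∘ₗ LinearMap.proj i + (B i).toEuclideanLin ∘ₗ LinearMap.proj (i + 1)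

/-- The block Jacobi operator on the finitely supported sequences. -/
def jacobiFin {m : ℕ} (A B : ℕ → Matrix (Fin m) (Fin m) ℂ) : BlockSeq m →ₗ.[ℂ] BlockSeq m where
  domain :=
    { carrier := {φ | (∃ N : ℕ, ∀ i ≥ N, φ i = 0) ∧ Memℓp (jacobiExpr A B (fun i => φ i)) 2}
      add_mem' := by
        rintro φ ψ ⟨⟨N, hN⟩, h⟩ ⟨⟨M, hM⟩, h'⟩
        refine ⟨⟨max N M, fun i hi => ?_⟩, ?_⟩
        · simp [hN i (le_trans (le_max_left _ _) hi), hM i (le_trans (le_max_right _ _) hi)]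
        · have := h.add h'
          rwa [← map_add] at this
      zero_mem' := by
        refine ⟨⟨0, fun i _ => rfl⟩, ?_⟩
        have : jacobiExpr A B (fun i => (0 : BlockSeq m) i) = 0 := map_zero (jacobiExpr A B)
        rw [this]
        exact zero_memℓp
      smul_mem' := by
        rintro c φ ⟨⟨N, hN⟩, h⟩
        refine ⟨⟨N, fun i hi => by simp [hN i hi]⟩, ?_⟩
        have := h.const_smul c
        rwa [← map_smul] at this }
  toFun :=
    { toFun := fun φ => ⟨jacobiExpr A B (fun i => φ.1 i), φ.2.2⟩
      map_add' := fun φ ψ => Subtype.ext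
        (map_add (jacobiExpr A B) (fun i => φ.1 i) (fun i => ψ.1 i))
      map_smul' := fun c φ => Subtype.ext (map_smul (jacobiExpr A B) c (fun i => φ.1 i)) }

/-- The minimal block Jacobi operator. -/
def jacobiMin {m : ℕ} (A B : ℕ → Matrix (Fin m) (Fin m) ℂ) : BlockSeq m →ₗ.[ℂ] BlockSeq m :=
  (jacobiFin A B).closure

/-- The numbers `β_k = √(k! (k+m)!) / (k-p)!`, used for `k ≥ p` only. -/
def heunWeight (p m k : ℕ) : ℝ :=
  Real.sqrt ((Nat.factorial k : ℝ) * (Nat.factorial (k + m) : ℝ)) / (Nat.factorial (k - p) : ℝ)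

/-- The `i`-th off-diagonal block (`i = 0, 1, …`): the diagonal matrix with the entries `β_k` for
`p + m i ≤ k < p + m (i + 1)`. -/
def heunBlock (p m : ℕ) (i : ℕ) : Matrix (Fin m) (Fin m) ℂ :=
  Matrix.diagonal fun j => (heunWeight p m (p + m * i + j) : ℂ)

/-- The spectral norm of a matrix. -/
def matrixSpectralNorm {m : ℕ} (M : Matrix (Fin m) (Fin m) ℂ) : ℝ :=
  ‖Matrix.toEuclideanCLM (n := Fin m) (𝕜 := ℂ) M‖

end

/-! For `k ≥ p` the Heun expression sends `e_k` to `β_k e_{k+m} + β_{k-m} e_{k-m}`, without the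
second term when `k - m < p`, and it kills `e_k` for `k < p`. It therefore splits along the residue
classes modulo `m` into `m` scalar Jacobi matrices with zero diagonal and positive weights, which is
the block form with diagonal blocks `B_i`.

A vector is orthogonal to `(H - z) D(H)` exactly when, in each class, its coefficients solve the
three-term recurrence with parameter `conj z`, and its coefficients at the `e_k` with `k < p`
vanish, because `z ≠ 0`. A solution is fixed by its first entry in each class, so the dimension is
at most `m`, and it equals `m` once every solution is square summable. That is Berezanskii's
criterion, `IsBerezanskii.summable_norm_sq`: the weights increase, are logarithmically concave, and
have summable inverses since `β_k` grows like `k ^ (p + m / 2)`.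

The operator theory is done once, for `IsBlockJacobi`: a graph spanned by explicit pairs determines
symmetry, deficiency spaces (`IsBlockJacobi.deficiencyNumber_closure`) and unitary equivalence. The
analytic input is that the `e_k` form an orthonormal basis and that Bargmann space is complete; both
rest on `integral_conj_pow_mul`, by which inner products with powers of `z` are derivatives at the
origin. -/

noncomputable section

/-! ## Square summability of the solutions of a three-term recurrence -/

/-- The solution of `b (n+1) u (n+2) + b n u n = z u (n+1)`, `b 0 u 1 = z u 0`, `u 0 = x`. -/
def jacobiSolution (b : ℕ → ℝ) (z x : ℂ) : ℕ → ℂ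
  | 0 => x
  | 1 => z * x / b 0
  | n + 2 => (z * jacobiSolution b z x (n + 1) - b n * jacobiSolution b z x n) / b (n + 1)

theorem jacobiSolution_one {b : ℕ → ℝ} (hb : ∀ n, 0 < b n) (z x : ℂ) :
    (b 0 : ℂ) * jacobiSolution b z x 1 = z * jacobiSolution b z x 0 := by
  have : (b 0 : ℂ) ≠ 0 := by exact_mod_cast (hb 0).ne'
  simp only [jacobiSolution]
  field_simp

theorem jacobiSolution_add_two {b : ℕ → ℝ} (hb : ∀ n, 0 < b n) (z x : ℂ) (n : ℕ) :
    (b (n + 1) : ℂ) * jacobiSolution b z x (n + 2) + b n * jacobiSolution b z x n =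
      z * jacobiSolution b z x (n + 1) := by
  have : (b (n + 1) : ℂ) ≠ 0 := by exact_mod_cast (hb (n + 1)).ne'
  conv_lhs => rw [jacobiSolution]
  field_simp
  ring

/-- The weights of Berezanskii's criterion: positive, nondecreasing, logarithmically concave and
with summable inverses. -/
structure IsBerezanskii (b : ℕ → ℝ) : Prop where
  pos : ∀ n, 0 < b n
  le_succ : ∀ n, b n ≤ b (n + 1)
  mul_le_sq : ∀ n, b n * b (n + 2) ≤ b (n + 1) ^ 2
  summable_inv : Summable fun n => (b n)⁻¹

/-- Discrete Gronwall inequality: each factor `1 + d n` is at most `exp (d n)`, so their products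
stay below the exponential of the sum. -/
theorem bddAbove_of_le_one_add_mul {Y d : ℕ → ℝ} (hY : 0 ≤ Y 0) (hd : ∀ n, 0 ≤ d n)
    (hsum : Summable d) (h : ∀ n, Y (n + 1) ≤ (1 + d n) * Y n) : ∃ C, ∀ n, Y n ≤ C := by
  refine ⟨Y 0 * Real.exp (∑' n, d n), fun n => ?_⟩
  have key : ∀ n, Y n ≤ Y 0 * Real.exp (∑ k ∈ Finset.range n, d k) := by
    intro n
    induction n with
    | zero => simp
    | succ n ih =>
      calc Y (n + 1) ≤ (1 + d n) * Y n := h n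
        _ ≤ (1 + d n) * (Y 0 * Real.exp (∑ k ∈ Finset.range n, d k)) :=
          mul_le_mul_of_nonneg_left ih (by linarith [hd n])
        _ ≤ Real.exp (d n) * (Y 0 * Real.exp (∑ k ∈ Finset.range n, d k)) :=
          mul_le_mul_of_nonneg_right (by linarith [Real.add_one_le_exp (d n)]) (by positivity)
        _ = _ := by rw [Finset.sum_range_succ, Real.exp_add]; ring
  refine (key n).trans (mul_le_mul_of_nonneg_left (Real.exp_le_exp.2 ?_) hY)
  exact hsum.sum_le_tsum _ fun k _ => hd k

/-- After the rescaling `x n = √(b n) ‖u (n + 1)‖`, the recurrence is governed by the quotients `P n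
= √(b (n + 1) / b n)`. These are at least `1` by monotonicity and nonincreasing by logarithmic
concavity. Hence `P n * max (x n) (x (n + 1))` grows per step by a factor of at most `1 + ‖z‖ / b (n
+ 1)` and stays bounded, which gives `‖u (n + 1)‖ ^ 2 ≤ C ^ 2 / b n`. -/
theorem IsBerezanskii.summable_norm_sq {b : ℕ → ℝ} (hb : IsBerezanskii b) {u : ℕ → ℂ} {z : ℂ}
    (hu : ∀ n, (b (n + 1) : ℂ) * u (n + 2) + b n * u n = z * u (n + 1)) :
    Summable fun n => ‖u n‖ ^ 2 := by
  set s : ℕ → ℝ := fun n => Real.sqrt (b n) with hs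
  have spos : ∀ n, 0 < s n := fun n => Real.sqrt_pos.2 (hb.pos n)
  have ssq : ∀ n, s n ^ 2 = b n := fun n => Real.sq_sqrt (hb.pos n).le
  have smono : ∀ n, s n ≤ s (n + 1) := fun n => Real.sqrt_le_sqrt (hb.le_succ n)
  have slc : ∀ n, s n * s (n + 2) ≤ s (n + 1) ^ 2 := by
    intro n
    refine (sq_le_sq₀ (by have := spos n; have := spos (n+2); positivity) (by positivity)).1 ?_
    rw [mul_pow, ssq, ssq, ssq]
    exact hb.mul_le_sq n
  set x : ℕ → ℝ := fun n => s n * ‖u (n + 1)‖ with hx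
  have xnn : ∀ n, 0 ≤ x n := fun n => mul_nonneg (spos n).le (norm_nonneg _)
  set P : ℕ → ℝ := fun n => s (n + 1) / s n with hP
  have P1 : ∀ n, 1 ≤ P n := fun n => (one_le_div (spos n)).2 (smono n)
  have Pan : ∀ n, P (n + 1) ≤ P n := by
    intro n
    rw [hP]
    simp only
    rw [div_le_div_iff₀ (spos _) (spos _)]
    nlinarith [slc n]
  set d : ℕ → ℝ := fun n => ‖z‖ * (b (n + 1))⁻¹ with hd
  have dnn : ∀ n, 0 ≤ d n := fun n => mul_nonneg (norm_nonneg _) (inv_nonneg.2 (hb.pos _).le)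
  have dsum : Summable d := ((summable_nat_add_iff 1).2 hb.summable_inv).mul_left _
  -- the weighted three-term inequality
  have hrec : ∀ n, P (n + 1) * x (n + 2) ≤ P (n + 1) * d n * x (n + 1) + P n * x n := by
    intro n
    have h1 : b (n + 2) * ‖u (n + 3)‖ ≤ ‖z‖ * ‖u (n + 2)‖ + b (n + 1) * ‖u (n + 1)‖ := by
      have := hu (n + 1)
      have h2 : (b (n + 2) : ℂ) * u (n + 3) = z * u (n + 2) - b (n + 1) * u (n + 1) :=
        eq_sub_of_add_eq this
      have h3 := congrArg norm h2
      rw [norm_mul, Complex.norm_real, Real.norm_of_nonneg (hb.pos _).le] at h3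
      rw [h3]
      refine (norm_sub_le _ _).trans ?_
      rw [norm_mul, norm_mul, Complex.norm_real, Real.norm_of_nonneg (hb.pos _).le]
    have e0 := spos n
    have e1 := spos (n + 1)
    have e2 := spos (n + 2)
    have h4 : P (n + 1) * x (n + 2) = (b (n + 2) * ‖u (n + 3)‖) / s (n + 1) := by
      rw [hP, hx, ← ssq]; simp only; field_simp
    have h5 : P n * x n = (b (n + 1) * ‖u (n + 1)‖) / s (n + 1) := by
      rw [hP, hx, ← ssq]; simp only; field_simp
    -- Inserting the factor `P (n + 1) ≥ 1` only enlarges the term with `z`; now every term carries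
    -- a weight `P`.
    have h6 : ‖z‖ * ‖u (n + 2)‖ / s (n + 1) ≤ P (n + 1) * d n * x (n + 1) := by
      have : P (n + 1) * d n * x (n + 1) = (‖z‖ * ‖u (n + 2)‖ / s (n + 1)) * P (n + 1) := by
        rw [hx, hd]; simp only; rw [← ssq]; field_simp
      rw [this]
      exact le_mul_of_one_le_right (by positivity) (P1 _)
    rw [h4, h5]
    calc _ ≤ (‖z‖ * ‖u (n + 2)‖ + b (n + 1) * ‖u (n + 1)‖) / s (n + 1) := by gcongr
      _ ≤ _ := by rw [add_div]; linarith
  obtain ⟨C, hC⟩ := bddAbove_of_le_one_add_mul (Y := fun n => P n * max (x n) (x (n + 1)))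
    (mul_nonneg (by linarith [P1 0]) (le_max_of_le_left (xnn 0))) dnn dsum (by
      intro n
      have hM := le_max_of_le_left (b := x n) (c := x (n + 1)) (xnn n)
      have a0 : x n ≤ max (x n) (x (n + 1)) := le_max_left _ _
      have a1 : x (n + 1) ≤ max (x n) (x (n + 1)) := le_max_right _ _
      set M := max (x n) (x (n + 1))
      have p0 : 0 ≤ P n := by linarith [P1 n]
      have p1 : 0 ≤ P (n + 1) := by linarith [P1 (n + 1)]
      have b1 : P (n + 1) * M ≤ P n * M := mul_le_mul_of_nonneg_right (Pan n) hM
      have b2 : 0 ≤ d n * (P n * M) := mul_nonneg (dnn n) (mul_nonneg p0 hM)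
      have b3 : d n * (P (n + 1) * M) ≤ d n * (P n * M) := mul_le_mul_of_nonneg_left b1 (dnn n)
      have b4 : P (n + 1) * x (n + 1) ≤ P (n + 1) * M := mul_le_mul_of_nonneg_left a1 p1
      have b5 : P n * x n ≤ P n * M := mul_le_mul_of_nonneg_left a0 p0
      have b6 := mul_le_mul_of_nonneg_left b4 (dnn n)
      rw [mul_max_of_nonneg _ _ p1]
      refine max_le (by nlinarith) ((hrec n).trans (by nlinarith)))
  rw [← summable_nat_add_iff 1]
  refine Summable.of_nonneg_of_le (fun n => by positivity) (fun n => ?_)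
    (hb.summable_inv.mul_left (C ^ 2))
  have h1 : x n ≤ C := by
    have hM := le_max_of_le_left (b := x n) (c := x (n + 1)) (xnn n)
    refine le_trans ?_ (hC n)
    exact (le_max_left _ _).trans (le_mul_of_one_le_left hM (P1 n))
  have h2 : x n ^ 2 ≤ C ^ 2 := pow_le_pow_left₀ (xnn n) h1 2
  rw [hx] at h2
  simp only [mul_pow, ssq] at h2
  rw [← div_eq_mul_inv, le_div_iff₀ (hb.pos n)]
  linarith

/-! ## The weights of the Heun operator -/

theorem heunWeight_add (p m r : ℕ) : heunWeight p m (p + r) =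
    Real.sqrt (((p + r).factorial : ℝ) * ((p + r + m).factorial : ℝ)) / (r.factorial : ℝ) := by
  simp [heunWeight]

theorem heunWeight_pos (p m k : ℕ) : 0 < heunWeight p m k := by
  unfold heunWeight
  positivity

/-- The quotient of two consecutive weights. -/
def heunRatio (p m r : ℕ) : ℝ :=
  Real.sqrt ((1 + p / (r + 1)) * (1 + (p + m) / (r + 1)))

theorem heunWeight_succ (p m r : ℕ) :
    heunWeight p m (p + (r + 1)) = heunRatio p m r * heunWeight p m (p + r) := by
  rw [heunWeight_add, heunWeight_add, heunRatio, ← mul_div_assoc, ← Real.sqrt_mul (by positivity)]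
  rw [show p + (r + 1) + m = (p + r + m) + 1 by ring, show p + (r + 1) = (p + r) + 1 by ring]
  simp only [Nat.factorial_succ, Nat.cast_mul]
  rw [div_eq_div_iff (by positivity) (by positivity)]
  have : (((p + r + 1 : ℕ) : ℝ) * (p + r).factorial * (((p + r + m + 1 : ℕ) : ℝ) *
      (p + r + m).factorial)) = ((r + 1 : ℕ) : ℝ) ^ 2 * ((1 + (p : ℝ) / (r + 1)) *
      (1 + ((p : ℝ) + m) / (r + 1)) * ((p + r).factorial * (p + r + m).factorial)) := by
    push_cast
    have : (r : ℝ) + 1 ≠ 0 := by positivity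
    field_simp
    ring
  rw [this, Real.sqrt_mul (by positivity), Real.sqrt_sq (by positivity)]
  ring

theorem one_le_heunRatio (p m r : ℕ) : 1 ≤ heunRatio p m r := by
  rw [heunRatio, Real.one_le_sqrt]
  have h1 : (0 : ℝ) ≤ p / (r + 1) := by positivity
  have h2 : (0 : ℝ) ≤ (p + m) / (r + 1) := by positivity
  nlinarith [mul_nonneg h1 h2]

theorem heunRatio_antitone (p m : ℕ) : Antitone (heunRatio p m) := by
  intro r s h
  have : (r : ℝ) ≤ s := by exact_mod_cast h
  unfold heunRatio
  gcongr

theorem heunWeight_monotone (p m : ℕ) : Monotone fun r => heunWeight p m (p + r) :=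
  monotone_nat_of_le_succ fun r => by
    rw [heunWeight_succ]
    exact le_mul_of_one_le_left (heunWeight_pos _ _ _).le (one_le_heunRatio _ _ _)

/-- The quotient of two weights at distance `l` is a product of consecutive ratios, each antitone,
hence antitone itself. A general distance is allowed because one scalar Jacobi matrix uses only
every `m`-th weight. -/
theorem heunWeight_mul_le_sq (p m l r : ℕ) :
    heunWeight p m (p + r) * heunWeight p m (p + (r + l + l)) ≤ heunWeight p m (p + (r + l)) ^ 2 := by
  have hA : Antitone fun r => heunWeight p m (p + (r + l)) / heunWeight p m (p + r) := by
    refine antitone_nat_of_succ_le fun r => ?_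
    have h1 := heunWeight_pos p m (p + r)
    have h2 := heunWeight_pos p m (p + (r + l))
    have h3 : 0 < heunRatio p m r := by linarith [one_le_heunRatio p m r]
    rw [show r + 1 + l = (r + l) + 1 by ring, heunWeight_succ, heunWeight_succ,
      div_le_div_iff₀ (by positivity) (by positivity)]
    have := mul_le_mul_of_nonneg_right (heunRatio_antitone p m (Nat.le_add_right r l))
      (mul_pos h1 h2).le
    nlinarith
  have := hA (Nat.le_add_right r l)
  simp only at this
  rw [div_le_div_iff₀ (heunWeight_pos _ _ _) (heunWeight_pos _ _ _)] at this
  linarith [sq (heunWeight p m (p + (r + l)))]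

/-- Without the root the weight is a polynomial in `r` of degree `2p + m`, the source of the
exponent `p + m / 2`. -/
theorem heunWeight_sq (p m r : ℕ) : heunWeight p m (p + r) ^ 2 =
    (((r + 1).ascFactorial p : ℕ) : ℝ) ^ 2 * (((r + 1 + p).ascFactorial m : ℕ) : ℝ) := by
  rw [heunWeight_add, div_pow, Real.sq_sqrt (by positivity)]
  have h1 := Nat.factorial_mul_ascFactorial r p
  have h2 := Nat.factorial_mul_ascFactorial (r + p) m
  rw [show p + r + m = r + p + m by ring, show p + r = r + p by ring, ← h2, ← h1,
    show r + 1 + p = r + p + 1 by ring]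
  push_cast
  field_simp

theorem le_heunWeight (p m r : ℕ) :
    ((r : ℝ) + 1) ^ ((p : ℝ) + (m : ℝ) / 2) ≤ heunWeight p m (p + r) := by
  have hr : (0 : ℝ) ≤ (r : ℝ) + 1 := by positivity
  refine (sq_le_sq₀ (by positivity) (heunWeight_pos _ _ _).le).1 ?_
  rw [heunWeight_sq, ← Real.rpow_natCast, ← Real.rpow_mul hr,
    show ((p : ℝ) + (m : ℝ) / 2) * ((2 : ℕ) : ℝ) = ((p * 2 + m : ℕ) : ℝ) by push_cast; ring,
    Real.rpow_natCast, pow_add, pow_mul]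
  have h1 : ((r : ℝ) + 1) ^ p ≤ (((r + 1).ascFactorial p : ℕ) : ℝ) := by
    exact_mod_cast Nat.pow_succ_le_ascFactorial (r + 1) p
  have h2 : ((r : ℝ) + 1) ^ m ≤ (((r + 1 + p).ascFactorial m : ℕ) : ℝ) := by
    refine le_trans ?_ (by exact_mod_cast Nat.pow_succ_le_ascFactorial (r + 1 + p) m :
      ((r : ℝ) + 1 + p) ^ m ≤ _)
    exact pow_le_pow_left₀ hr (le_add_of_nonneg_right p.cast_nonneg) m
  gcongr

/-- The growth condition `1 < p + m / 2` enters here: the inverse weights are dominated by the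
convergent series of `(n + 1) ^ (-(p + m / 2))`. -/
theorem isBerezanskii_heunWeight {p m : ℕ} (hm : 1 ≤ m) (hpm : (1 : ℝ) < (p : ℝ) + (m : ℝ) / 2)
    (j : ℕ) : IsBerezanskii fun i => heunWeight p m (p + m * i + j) where
  pos n := heunWeight_pos _ _ _
  le_succ n := by
    rw [add_assoc, add_assoc]
    exact heunWeight_monotone p m (by gcongr; omega)
  mul_le_sq n := by
    have := heunWeight_mul_le_sq p m m (m * n + j)
    convert this using 3 <;> ring
  summable_inv := by
    have h := (summable_nat_add_iff 1).2 (Real.summable_nat_rpow_inv.2 hpm)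
    refine Summable.of_nonneg_of_le (fun n => (inv_pos.2 (heunWeight_pos _ _ _)).le)
      (fun n => ?_) h
    refine inv_anti₀ (by positivity) ?_
    refine le_trans ?_ (add_assoc p (m * n) j ▸ le_heunWeight p m (m * n + j))
    have : n ≤ m * n + j := by nlinarith
    have : (n : ℝ) ≤ ((m * n + j : ℕ) : ℝ) := by exact_mod_cast this
    push_cast at this ⊢
    gcongr

/-! ### Asymptotics of the weights and of the spectral norms of the blocks -/

theorem tendsto_ascFactorial_div_pow (a k : ℕ) :
    Tendsto (fun n : ℕ => (((n + a).ascFactorial k : ℕ) : ℝ) / (n : ℝ) ^ k) atTop (𝓝 1) := by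
  induction k with
  | zero => simp
  | succ k ih =>
    have h1 : Tendsto (fun n : ℕ => 1 + ((a : ℝ) + k) / (n : ℝ)) atTop (𝓝 (1 + 0)) :=
      tendsto_const_nhds.add (tendsto_const_div_atTop_nhds_zero_nat _)
    rw [add_zero] at h1
    have h2 := h1.mul ih
    rw [mul_one] at h2
    refine h2.congr' ?_
    filter_upwards [eventually_gt_atTop 0] with n hn
    have : (n : ℝ) ≠ 0 := by positivity
    rw [Nat.ascFactorial_succ]
    push_cast
    field_simp
    ring

/-- The shift `n - 1` is chosen for `n = m (i + 1)`, when `p + (n - 1)` is the last index of the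
block `i`. -/
theorem tendsto_heunWeight_div (p m : ℕ) :
    Tendsto (fun n : ℕ => heunWeight p m (p + (n - 1)) / (n : ℝ) ^ ((p : ℝ) + (m : ℝ) / 2))
      atTop (𝓝 1) := by
  have h1 := ((tendsto_ascFactorial_div_pow 0 p).pow 2).mul (tendsto_ascFactorial_div_pow p m)
  rw [one_pow, mul_one] at h1
  have h2 := (Real.continuous_sqrt.tendsto 1).comp h1
  rw [Real.sqrt_one] at h2
  refine h2.congr' ?_
  filter_upwards [eventually_gt_atTop 0] with n hn
  obtain ⟨r, rfl⟩ : ∃ r, n = r + 1 := ⟨n - 1, by omega⟩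
  have hr : (0 : ℝ) ≤ ((r + 1 : ℕ) : ℝ) := by positivity
  rw [Function.comp_apply, Real.sqrt_eq_iff_eq_sq (by positivity)
    (div_nonneg (heunWeight_pos _ _ _).le (by positivity)), div_pow (heunWeight _ _ _),
    Nat.add_sub_cancel,
    heunWeight_sq, ← Real.rpow_natCast (_ ^ (_ : ℝ)), ← Real.rpow_mul hr,
    show ((p : ℝ) + (m : ℝ) / 2) * ((2 : ℕ) : ℝ) = ((p * 2 + m : ℕ) : ℝ) by push_cast; ring,
    Real.rpow_natCast, pow_add, pow_mul]
  simp only [add_zero]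
  field_simp

open scoped Matrix.Norms.L2Operator in
theorem matrixSpectralNorm_diagonal {m : ℕ} (v : Fin m → ℂ) :
    matrixSpectralNorm (Matrix.diagonal v) = ‖v‖ :=
  Matrix.l2_opNorm_diagonal v

/-- The norm of a diagonal matrix is its largest entry in modulus; since the weights increase, this
is the last entry of the block. -/
theorem matrixSpectralNorm_heunBlock {p m : ℕ} (hm : 1 ≤ m) (i : ℕ) :
    matrixSpectralNorm (heunBlock p m i) = heunWeight p m (p + (m * (i + 1) - 1)) := by
  rw [heunBlock, matrixSpectralNorm_diagonal]
  have hn : ∀ j : Fin m, ‖(heunWeight p m (p + m * i + j) : ℂ)‖ =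
      heunWeight p m (p + (m * i + j)) := fun j => by
    rw [Complex.norm_real, Real.norm_of_nonneg (heunWeight_pos _ _ _).le, add_assoc]
  refine le_antisymm ((pi_norm_le_iff_of_nonneg (heunWeight_pos _ _ _).le).2 fun j => ?_) ?_
  · rw [hn]
    refine heunWeight_monotone p m ?_
    have := j.2
    rw [mul_add, mul_one]
    omega
  · have := norm_le_pi_norm (fun j : Fin m => (heunWeight p m (p + m * i + j) : ℂ))
      ⟨m - 1, by omega⟩
    rw [hn] at this
    refine le_of_eq_of_le ?_ this
    congr 2
    rw [mul_add, mul_one]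
    simp only
    omega

theorem matrixSpectralNorm_heunBlock_isEquivalent {p m : ℕ} (hm : 1 ≤ m) :
    (fun i : ℕ => matrixSpectralNorm (heunBlock p m i)) ~[atTop]
      (fun i : ℕ => ((m : ℝ) * ((i : ℝ) + 1)) ^ ((p : ℝ) + (m : ℝ) / 2)) := by
  have hm' : (0 : ℝ) < m := by exact_mod_cast hm
  refine (isEquivalent_iff_tendsto_one (Eventually.of_forall fun i => by positivity)).2 ?_
  have h : Tendsto (fun i : ℕ => m * (i + 1)) atTop atTop :=
    tendsto_atTop_mono (fun i => i.le_succ.trans (Nat.le_mul_of_pos_left _ hm)) tendsto_id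
  refine ((tendsto_heunWeight_div p m).comp h).congr fun i => ?_
  simp [matrixSpectralNorm_heunBlock hm]

/-! ## Operators given on an orthonormal basis -/

/-! ### Symmetry and deficiency spaces from a spanning set of the graph -/

section BlockJacobi

variable {E : Type*} [NormedAddCommGroup E] [InnerProductSpace ℂ E]
variable {F : Type*} [NormedAddCommGroup F] [InnerProductSpace ℂ F]
variable {ι κ : Type*}

/-- On graphs, symmetry is a closed sesquilinear condition, so it can be tested on generators and
passes to closures. -/
theorem isFormalAdjoint_iff_graph {T S : E →ₗ.[ℂ] E} :
    T.IsFormalAdjoint S ↔ ∀ x ∈ T.graph, ∀ y ∈ S.graph, ⟪x.2, y.1⟫_ℂ = ⟪x.1, y.2⟫_ℂ := by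
  constructor
  · rintro h x hx y hy
    obtain ⟨a, ha, ha'⟩ := (LinearPMap.mem_graph_iff _).1 hx
    obtain ⟨c, hc, hc'⟩ := (LinearPMap.mem_graph_iff _).1 hy
    rw [← ha, ← ha', ← hc, ← hc']
    exact h a c
  · intro h x y
    exact h _ (T.mem_graph x) _ (S.mem_graph y)

/-- A densely defined symmetric operator is contained in its adjoint, which is closed. -/
theorem LinearPMap.IsFormalAdjoint.isClosable [CompleteSpace E] {T : E →ₗ.[ℂ] E}
    (h : T.IsFormalAdjoint T) (hd : Dense (T.domain : Set E)) : T.IsClosable :=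
  (LinearPMap.adjoint_isClosed hd).isClosable.leIsClosable (h.le_adjoint hd)

theorem isFormalAdjoint_of_graph_eq_span {T : E →ₗ.[ℂ] E} {s : Set (E × E)}
    (hs : T.graph = Submodule.span ℂ s)
    (h : ∀ x ∈ s, ∀ y ∈ s, ⟪x.2, y.1⟫_ℂ = ⟪x.1, y.2⟫_ℂ) : T.IsFormalAdjoint T := by
  rw [isFormalAdjoint_iff_graph, hs]
  intro x hx y hy
  induction hx using Submodule.span_induction with
  | zero => simp
  | add a c _ _ ha hc => simp only [Prod.fst_add, Prod.snd_add, inner_add_left, ha, hc]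
  | smul r a _ ha => simp only [Prod.smul_fst, Prod.smul_snd, inner_smul_left, ha]
  | mem x hx =>
    induction hy using Submodule.span_induction with
    | zero => simp
    | add a c _ _ ha hc => simp only [Prod.fst_add, Prod.snd_add, inner_add_right, ha, hc]
    | smul r a _ ha => simp only [Prod.smul_fst, Prod.smul_snd, inner_smul_right, ha]
    | mem y hy => exact h x hx y hy

theorem isClosedSymmetric_closure [CompleteSpace E] {T : E →ₗ.[ℂ] E}
    (h : T.IsFormalAdjoint T) (hd : Dense (T.domain : Set E)) :
    IsClosedSymmetric T.closure := by
  have hc := h.isClosable hd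
  refine ⟨hd.mono (T.le_closure.1), hc.closure_isClosed, ?_⟩
  have hg : (T.closure.graph : Set (E × E)) = closure (T.graph : Set (E × E)) := by
    rw [← hc.graph_closure_eq_closure_graph, Submodule.topologicalClosure_coe]
  rw [isFormalAdjoint_iff_graph] at h ⊢
  -- The closure is taken in one variable at a time, the other pair being fixed.
  have h1 : ∀ x ∈ T.graph, ∀ y ∈ T.closure.graph, ⟪x.2, y.1⟫_ℂ = ⟪x.1, y.2⟫_ℂ := by
    intro x hx y hy
    have hcl : IsClosed {y : E × E | ⟪x.2, y.1⟫_ℂ = ⟪x.1, y.2⟫_ℂ} :=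
      isClosed_eq (by fun_prop) (by fun_prop)
    have hy' : y ∈ closure (T.graph : Set (E × E)) := hg ▸ hy
    exact closure_minimal (fun y hy => h x hx y hy) hcl hy'
  intro x hx y hy
  have hcl : IsClosed {x : E × E | ⟪x.2, y.1⟫_ℂ = ⟪x.1, y.2⟫_ℂ} :=
    isClosed_eq (by fun_prop) (by fun_prop)
  have hx' : x ∈ closure (T.graph : Set (E × E)) := hg ▸ hx
  exact closure_minimal (fun x hx => h1 x hx y hy) hcl hx'

/-- The orthogonality condition is conjugate linear and closed in the pair `x`, so it extends from
the generators to their span and then to the closure of the graph. -/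
theorem mem_deficiency_iff {T : E →ₗ.[ℂ] E} (hc : T.IsClosable) {s : Set (E × E)}
    (hs : T.graph = Submodule.span ℂ s) (z : ℂ) (g : E) :
    g ∈ (LinearMap.range (T.closure.toFun - z • T.closure.domain.subtype))ᗮ ↔
      ∀ x ∈ s, ⟪x.2 - z • x.1, g⟫_ℂ = 0 := by
  rw [Submodule.mem_orthogonal]
  have hg : (T.closure.graph : Set (E × E)) = closure (T.graph : Set (E × E)) := by
    rw [← hc.graph_closure_eq_closure_graph, Submodule.topologicalClosure_coe]
  constructor
  · intro h x hx
    have h1 : x ∈ T.graph := hs ▸ Submodule.subset_span hx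
    have h2 : x ∈ T.closure.graph := LinearPMap.le_graph_of_le T.le_closure h1
    obtain ⟨a, ha, ha'⟩ := (LinearPMap.mem_graph_iff _).1 h2
    refine h _ ⟨a, ?_⟩
    rw [← ha, ← ha']
    rfl
  · rintro h _ ⟨a, rfl⟩
    have h1 : ∀ x ∈ T.graph, ⟪x.2 - z • x.1, g⟫_ℂ = 0 := by
      intro x hx
      rw [hs] at hx
      induction hx using Submodule.span_induction with
      | zero => simp
      | add a c _ _ ha hc =>
        rw [Prod.fst_add, Prod.snd_add, smul_add, add_sub_add_comm, inner_add_left, ha, hc, add_zero]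
      | smul r a _ ha =>
        rw [Prod.smul_fst, Prod.smul_snd, smul_comm z r, ← smul_sub, inner_smul_left, ha, mul_zero]
      | mem x hx => exact h x hx
    have hcl : IsClosed {x : E × E | ⟪x.2 - z • x.1, g⟫_ℂ = 0} :=
      isClosed_eq (by fun_prop) (by fun_prop)
    have h2 : ((a : E), T.closure a) ∈ closure (T.graph : Set (E × E)) :=
      hg ▸ T.closure.mem_graph a
    exact closure_minimal (fun x hx => h1 x hx) hcl h2

/-- Under a unitary map that carries the graph of `T` to the graph of `S`, the closures
correspond as well. -/
theorem mem_graph_closure_iff_of_map {T : E →ₗ.[ℂ] E} {S : F →ₗ.[ℂ] F} (hT : T.IsClosable)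
    (hS : S.IsClosable) (U : E ≃ₗᵢ[ℂ] F) (h : ∀ x y, (x, y) ∈ T.graph ↔ (U x, U y) ∈ S.graph)
    (x y : E) : (x, y) ∈ T.closure.graph ↔ (U x, U y) ∈ S.closure.graph := by
  let e : E × E ≃ₜ F × F := U.toHomeomorph.prodCongr U.toHomeomorph
  have he : e ⁻¹' (S.graph : Set (F × F)) = (T.graph : Set (E × E)) := by
    ext ⟨a, c⟩
    exact (h a c).symm
  rw [← hT.graph_closure_eq_closure_graph, ← hS.graph_closure_eq_closure_graph,
    ← SetLike.mem_coe, ← SetLike.mem_coe, Submodule.topologicalClosure_coe,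
    Submodule.topologicalClosure_coe, ← he, ← e.preimage_closure]
  rfl

/-- `T` is defined on the span of the basis `b` and acts on the part of the basis that is indexed
by `ℕ × κ` as a block Jacobi matrix with zero diagonal blocks and the diagonal off-diagonal blocks
`w i`, and as zero on the rest of the basis. -/
structure IsBlockJacobi (b : ι → E) (f : ℕ × κ → ι) (w : ℕ → κ → ℝ) (T : E →ₗ.[ℂ] E) : Prop where
  domain_eq : T.domain = Submodule.span ℂ (Set.range b)
  zero_mem : ∀ j, (b (f (0, j)), (w 0 j : ℂ) • b (f (1, j))) ∈ T.graph
  succ_mem : ∀ n j, (b (f (n + 1, j)),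
    (w (n + 1) j : ℂ) • b (f (n + 2, j)) + (w n j : ℂ) • b (f (n, j))) ∈ T.graph
  other_mem : ∀ k, k ∉ Set.range f → (b k, 0) ∈ T.graph

/-- The pairs `(b k, T (b k))` for an operator as in `IsBlockJacobi`. -/
def blockJacobiPairs (b : ι → E) (f : ℕ × κ → ι) (w : ℕ → κ → ℝ) : Set (E × E) :=
  (Set.range fun j => (b (f (0, j)), (w 0 j : ℂ) • b (f (1, j)))) ∪
  (Set.range fun q : ℕ × κ => (b (f (q.1 + 1, q.2)),
    (w (q.1 + 1) q.2 : ℂ) • b (f (q.1 + 2, q.2)) + (w q.1 q.2 : ℂ) • b (f (q.1, q.2)))) ∪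
  (fun k => (b k, 0)) '' (Set.range f)ᶜ

/-- Only finitely many columns are glued together, so square summability of each one suffices. -/
theorem memℓp_extend [Finite κ] {f : ℕ × κ → ι} (hf : Function.Injective f) (u : ℕ × κ → ℂ)
    (hu : ∀ j, Summable fun n => ‖u (n, j)‖ ^ 2) : Memℓp (Function.extend f u (0 : ι → ℂ)) 2 := by
  have hsum : Summable fun q => ‖u q‖ ^ 2 := by
    rw [← (Equiv.prodComm κ ℕ).summable_iff, summable_prod_of_nonneg fun q => by
      simp only [Function.comp_apply, Pi.zero_apply]; positivity]
    exact ⟨hu, Summable.of_finite⟩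
  rw [memℓp_gen_iff (by norm_num)]
  simp only [ENNReal.toReal_ofNat, Real.rpow_ofNat]
  rw [← hf.summable_iff fun k hk => ?_]
  · refine hsum.congr fun q => ?_
    rw [Function.comp_apply, hf.extend_apply]
  · rw [Function.extend_apply' u (0 : ι → ℂ) k hk]
    simp

/-! ### Block Jacobi operators: symmetry, unitary equivalence and deficiency numbers -/

namespace IsBlockJacobi

/-- The span of the pairs lies in the graph and already projects onto the whole domain;
single-valuedness of the graph leaves nothing else. -/
theorem graph_eq {b : ι → E} {f : ℕ × κ → ι} {w : ℕ → κ → ℝ} {T : E →ₗ.[ℂ] E}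
    (hT : IsBlockJacobi b f w T) : T.graph = Submodule.span ℂ (blockJacobiPairs b f w) := by
  have hle : Submodule.span ℂ (blockJacobiPairs b f w) ≤ T.graph := by
    refine Submodule.span_le.2 ?_
    rintro _ ((⟨j, rfl⟩ | ⟨q, rfl⟩) | ⟨k, hk, rfl⟩)
    · exact hT.zero_mem j
    · exact hT.succ_mem q.1 q.2
    · exact hT.other_mem k hk
  refine le_antisymm ?_ hle
  have hdom : T.domain ≤ (Submodule.span ℂ (blockJacobiPairs b f w)).map (LinearMap.fst ℂ E E) := by
    rw [hT.domain_eq, Submodule.map_span]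
    refine Submodule.span_mono ?_
    rintro _ ⟨k, rfl⟩
    by_cases hk : k ∈ Set.range f
    · obtain ⟨⟨n, j⟩, rfl⟩ := hk
      cases n with
      | zero => exact ⟨_, Or.inl (Or.inl ⟨j, rfl⟩), rfl⟩
      | succ n => exact ⟨_, Or.inl (Or.inr ⟨(n, j), rfl⟩), rfl⟩
    · exact ⟨_, Or.inr ⟨k, hk, rfl⟩, rfl⟩
  rintro ⟨x, y⟩ hx
  obtain ⟨⟨x', y'⟩, hq, hq'⟩ := hdom (LinearPMap.mem_domain_of_mem_graph hx)
  simp only [LinearMap.fst_apply] at hq'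
  subst hq'
  rwa [T.mem_graph_snd_inj hx (hle hq) rfl]

theorem dense_domain {b : HilbertBasis ι ℂ E} {f : ℕ × κ → ι} {w : ℕ → κ → ℝ} {T : E →ₗ.[ℂ] E}
    (hT : IsBlockJacobi b f w T) : Dense (T.domain : Set E) := by
  rw [hT.domain_eq, Submodule.dense_iff_topologicalClosure_eq_top]
  exact b.dense_span

theorem mem_graph_iff_of_map {b : ι → E} {f : ℕ × κ → ι} {w : ℕ → κ → ℝ} {T : E →ₗ.[ℂ] E}
    (hT : IsBlockJacobi b f w T) {c : ι → F} {S : F →ₗ.[ℂ] F} (hS : IsBlockJacobi c f w S)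
    (U : E ≃ₗᵢ[ℂ] F) (hU : ∀ k, U (b k) = c k) (x y : E) :
    (x, y) ∈ T.graph ↔ (U x, U y) ∈ S.graph := by
  let L : E × E →ₗ[ℂ] F × F := U.toLinearEquiv.toLinearMap.prodMap U.toLinearEquiv.toLinearMap
  have hL : Function.Injective L := by
    rintro ⟨a, a'⟩ ⟨d, d'⟩ h
    exact Prod.ext (U.injective (congrArg Prod.fst h)) (U.injective (congrArg Prod.snd h))
  have him : L '' blockJacobiPairs b f w = blockJacobiPairs c f w := by
    simp only [blockJacobiPairs, Set.image_union, ← Set.range_comp, Set.image_image]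
    congr 1
    · congr 1
      · congr 1; ext j <;> simp [L, hU]
      · congr 1; ext q <;> simp [L, hU, map_add]
    · congr 1; ext q <;> simp [L, hU]
  rw [hT.graph_eq, hS.graph_eq, ← him, ← Submodule.map_span]
  change _ ↔ L (x, y) ∈ _
  exact ⟨Submodule.mem_map_of_mem, fun ⟨q, hq, h⟩ => hL h ▸ hq⟩

/-- The matrix is real and symmetric: `w n j` couples the positions `n` and `n + 1` of column `j` in
both directions. -/
theorem isFormalAdjoint {b : ι → E} (hb : Orthonormal ℂ b) {f : ℕ × κ → ι}
    (hf : Function.Injective f) {w : ℕ → κ → ℝ} {T : E →ₗ.[ℂ] E}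
    (hT : IsBlockJacobi b f w T) : T.IsFormalAdjoint T := by
  classical
  refine isFormalAdjoint_of_graph_eq_span hT.graph_eq ?_
  have hi := orthonormal_iff_ite.1 hb
  have hn := hb.norm_eq_one
  rintro _ ((⟨j, rfl⟩ | ⟨⟨n, j⟩, rfl⟩) | ⟨k, hk, rfl⟩) _ ((⟨j', rfl⟩ | ⟨⟨n', j'⟩, rfl⟩) | ⟨k', hk', rfl⟩)
  · simp [hi, hf.eq_iff]
  · rcases eq_or_ne j j' with rfl | h
    · rcases eq_or_ne n' 0 with rfl | h'
      · simp [hi, hn, hf.eq_iff]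
      · simp [hi, hf.eq_iff, h', h'.symm]
    · simp [hi, hf.eq_iff, h]
  · have : ∀ q, f q ≠ k' := fun q h => hk' ⟨q, h⟩
    simp [hi, this]
  · rcases eq_or_ne j j' with rfl | h
    · rcases eq_or_ne n 0 with rfl | h'
      · simp [hi, hn, hf.eq_iff]
      · simp [hi, hf.eq_iff, h']
    · simp [hi, hf.eq_iff, h]
  · rcases eq_or_ne j j' with rfl | h
    · rcases eq_or_ne n' (n + 1) with rfl | h1
      · have : n ≠ n + 1 + 1 := by omega
        simp [hi, hn, hf.eq_iff, this]
      · rcases eq_or_ne n (n' + 1) with rfl | h2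
        · have : n' + 1 + 1 ≠ n' := by omega
          simp [hi, hn, hf.eq_iff, this]
        · simp [hi, hf.eq_iff, h1.symm, h2]
    · simp [hi, hf.eq_iff, h]
  · have : ∀ q, f q ≠ k' := fun q h => hk' ⟨q, h⟩
    simp [hi, this]
  · have : ∀ q, k ≠ f q := fun q h => hk ⟨q, h.symm⟩
    simp [hi, this]
  · have : ∀ q, k ≠ f q := fun q h => hk ⟨q, h.symm⟩
    simp [hi, this]
  · simp

theorem isClosable [CompleteSpace E] {b : HilbertBasis ι ℂ E} {f : ℕ × κ → ι}
    (hf : Function.Injective f) {w : ℕ → κ → ℝ} {T : E →ₗ.[ℂ] E} (hT : IsBlockJacobi b f w T) :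
    T.IsClosable :=
  (hT.isFormalAdjoint b.orthonormal hf).isClosable hT.dense_domain

theorem mem_deficiency_iff {b : ι → E} {f : ℕ × κ → ι} {w : ℕ → κ → ℝ} {T : E →ₗ.[ℂ] E}
    (hT : IsBlockJacobi b f w T) (hc : T.IsClosable) {z : ℂ} (hz : z ≠ 0) (g : E) :
    g ∈ (LinearMap.range (T.closure.toFun - z • T.closure.domain.subtype))ᗮ ↔
      (∀ j, (w 0 j : ℂ) * ⟪b (f (1, j)), g⟫_ℂ = conj z * ⟪b (f (0, j)), g⟫_ℂ) ∧
      (∀ n j, (w (n + 1) j : ℂ) * ⟪b (f (n + 2, j)), g⟫_ℂ + w n j * ⟪b (f (n, j)), g⟫_ℂ =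
        conj z * ⟪b (f (n + 1, j)), g⟫_ℂ) ∧
      ∀ k, k ∉ Set.range f → ⟪b k, g⟫_ℂ = 0 := by
  rw [_root_.mem_deficiency_iff hc hT.graph_eq]
  constructor
  · intro h
    refine ⟨fun j => ?_, fun n j => ?_, fun k hk => ?_⟩
    · have := h _ (Or.inl (Or.inl ⟨j, rfl⟩))
      rw [inner_sub_left, inner_smul_left, inner_smul_left, Complex.conj_ofReal] at this
      exact sub_eq_zero.1 this
    · have := h _ (Or.inl (Or.inr ⟨(n, j), rfl⟩))
      rw [inner_sub_left, inner_add_left, inner_smul_left, inner_smul_left, inner_smul_left,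
        Complex.conj_ofReal, Complex.conj_ofReal] at this
      exact sub_eq_zero.1 this
    -- `T` kills `b k`, so the condition says that `conj z * ⟪b k, g⟫` vanishes, and `z ≠ 0` can be
    -- cancelled.
    · have := h _ (Or.inr ⟨k, hk, rfl⟩)
      simpa [inner_smul_left, hz] using this
  · rintro ⟨h0, h1, h2⟩ _ ((⟨j, rfl⟩ | ⟨⟨n, j⟩, rfl⟩) | ⟨k, hk, rfl⟩)
    · rw [inner_sub_left, inner_smul_left, inner_smul_left, Complex.conj_ofReal]
      exact sub_eq_zero.2 (h0 j)
    · rw [inner_sub_left, inner_add_left, inner_smul_left, inner_smul_left, inner_smul_left,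
        Complex.conj_ofReal, Complex.conj_ofReal]
      exact sub_eq_zero.2 (h1 n j)
    · simp [inner_smul_left, h2 k hk]

/-- Reading off the `m` coefficients in the block `0` is an isomorphism of the deficiency space onto
`ℂ^m`. It is injective because the recurrence with nonzero weights propagates zeros, and surjective
because every solution is square summable. -/
theorem deficiencyNumber_closure [CompleteSpace E] {m : ℕ} {b : HilbertBasis ι ℂ E}
    {f : ℕ × Fin m → ι} (hf : Function.Injective f) {w : ℕ → Fin m → ℝ} {T : E →ₗ.[ℂ] E}
    (hT : IsBlockJacobi b f w T) (hw : ∀ j, IsBerezanskii fun i => w i j) {z : ℂ} (hz : z ≠ 0) :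
    deficiencyNumber T.closure z = m := by
  have hc : T.IsClosable := hT.isClosable hf
  set N := (LinearMap.range (T.closure.toFun - z • T.closure.domain.subtype))ᗮ with hN
  let L : N →ₗ[ℂ] (Fin m → ℂ) :=
    LinearMap.pi fun j => (innerₛₗ ℂ (b (f (0, j)))) ∘ₗ N.subtype
  have hLapp : ∀ g j, L g j = ⟪b (f (0, j)), (g : E)⟫_ℂ := fun g j => rfl
  have hinj : Function.Injective L := by
    rw [← LinearMap.ker_eq_bot, LinearMap.ker_eq_bot']
    rintro ⟨g, hg⟩ h
    have h0 : ∀ j, ⟪b (f (0, j)), g⟫_ℂ = 0 := fun j => congrFun h j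
    obtain ⟨h1, h2, h3⟩ := (hT.mem_deficiency_iff hc hz g).1 hg
    have key : ∀ n j, ⟪b (f (n, j)), g⟫_ℂ = 0 ∧ ⟪b (f (n + 1, j)), g⟫_ℂ = 0 := by
      intro n j
      have hne : ∀ n, (w n j : ℂ) ≠ 0 := fun n => by exact_mod_cast ((hw j).pos n).ne'
      induction n with
      | zero =>
        have := h1 j
        rw [h0 j, mul_zero] at this
        exact ⟨h0 j, (mul_eq_zero.1 this).resolve_left (hne 0)⟩
      | succ n ih =>
        have := h2 n j
        rw [ih.1, ih.2, mul_zero, mul_zero, add_zero] at this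
        exact ⟨ih.2, (mul_eq_zero.1 this).resolve_left (hne (n + 1))⟩
    refine Subtype.ext (b.repr.injective (lp.ext (funext fun k => ?_)))
    rw [b.repr_apply_apply]
    simp only [ZeroMemClass.coe_zero, map_zero]
    by_cases hk : k ∈ Set.range f
    · obtain ⟨⟨n, j⟩, rfl⟩ := hk
      exact (key n j).1
    · exact h3 k hk
  have hsurj : Function.Surjective L := by
    intro x
    -- Each column is a separate scalar recurrence started at `x j`. The parameter is `conj z` since
    -- `z` stands in the conjugate linear slot of the inner product.
    let u : ℕ × Fin m → ℂ := fun q => jacobiSolution (fun i => w i q.2) (conj z) (x q.2) q.1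
    let c : ι → ℂ := Function.extend f u (0 : ι → ℂ)
    have hcf : ∀ q, c (f q) = u q := fun q => hf.extend_apply u (0 : ι → ℂ) q
    have hc0 : ∀ k, k ∉ Set.range f → c k = 0 := fun k hk =>
      Function.extend_apply' u (0 : ι → ℂ) k (fun h => hk h)
    have hs : ∀ j, Summable fun n => ‖u (n, j)‖ ^ 2 := fun j =>
      (hw j).summable_norm_sq (jacobiSolution_add_two (hw j).pos (conj z) (x j))
    have hmem : Memℓp c 2 := memℓp_extend hf u hs
    let g : E := b.repr.symm ⟨c, hmem⟩
    have hg : ∀ k, ⟪b k, g⟫_ℂ = c k := fun k => by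
      rw [← b.repr_apply_apply]
      simp [g]
    have hgN : g ∈ N := by
      refine (hT.mem_deficiency_iff hc hz g).2 ⟨fun j => ?_, fun n j => ?_, fun k hk => ?_⟩
      · simp only [hg, hcf, u]
        exact jacobiSolution_one (hw j).pos _ _
      · simp only [hg, hcf, u]
        exact jacobiSolution_add_two (hw j).pos _ _ n
      · rw [hg, hc0 k hk]
    refine ⟨⟨g, hgN⟩, funext fun j => ?_⟩
    rw [hLapp, hg, hcf]
    rfl
  have := (LinearEquiv.ofBijective L ⟨hinj, hsurj⟩).lift_rank_eq
  simpa [deficiencyNumber] using this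

theorem isCompletelyIndeterminate_closure [CompleteSpace E] {m : ℕ} {b : HilbertBasis ι ℂ E}
    {f : ℕ × Fin m → ι} (hf : Function.Injective f) {w : ℕ → Fin m → ℝ} {T : E →ₗ.[ℂ] E}
    (hT : IsBlockJacobi b f w T) (hw : ∀ j, IsBerezanskii fun i => w i j) :
    IsCompletelyIndeterminate m T.closure := by
  constructor <;> intro z hz <;> refine hT.deficiencyNumber_closure hf hw ?_ <;>
    rintro rfl <;> simp at hz

end IsBlockJacobi

end BlockJacobi

/-! ## The orthonormal basis of Bargmann space -/

/-! ### Gaussian integrals of entire functions in polar coordinates -/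

section Gaussian

/-- On the circle `conj w = r ^ 2 / w`, so up to a constant this is Cauchy's integral of `f w / w ^
(k + 1)`. -/
theorem integral_conj_pow_mul_circleMap {f : ℂ → ℂ} (hf : Differentiable ℂ f) (k : ℕ) {r : ℝ}
    (hr : 0 < r) :
    ∫ θ in Set.Ioo (-Real.pi) Real.pi, conj (circleMap 0 r θ) ^ k * f (circleMap 0 r θ) =
      2 * Real.pi * (r : ℂ) ^ (2 * k) / k.factorial * iteratedDeriv k f 0 := by
  have h := Complex.circleIntegral_one_div_sub_center_pow_smul_of_differentiable_on_off_countable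
    (c := 0) hr k Set.countable_empty hf.continuous.continuousOn (fun z _ => hf z)
  have hrc : (r : ℂ) ≠ 0 := by exact_mod_cast hr.ne'
  have hper : Function.Periodic
      (fun θ : ℝ => conj (circleMap 0 r θ) ^ k * f (circleMap 0 r θ)) (2 * Real.pi) := by
    intro θ
    simp only [(periodic_circleMap 0 r) θ]
  have hint : ∀ θ : ℝ, deriv (circleMap 0 r) θ • ((1 / (circleMap 0 r θ - 0) ^ (k + 1)) •
      f (circleMap 0 r θ)) = (Complex.I / (r : ℂ) ^ (2 * k)) *
        (conj (circleMap 0 r θ) ^ k * f (circleMap 0 r θ)) := by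
    intro θ
    have hw : circleMap 0 r θ ≠ 0 := circleMap_ne_center hr.ne'
    have hc : circleMap 0 r θ * conj (circleMap 0 r θ) = (r : ℂ) ^ 2 := by
      rw [Complex.mul_conj, Complex.normSq_eq_norm_sq, norm_circleMap_zero, sq_abs]
      push_cast
      rfl
    rw [deriv_circleMap, sub_zero, smul_eq_mul, smul_eq_mul, pow_mul, ← hc]
    have hcw : conj (circleMap 0 r θ) ≠ 0 := by simpa using hw
    field_simp
    ring
  rw [circleIntegral] at h
  simp_rw [hint] at h
  rw [intervalIntegral.integral_const_mul] at h
  -- Periodicity moves the interval from `(0, 2π)` to `(-π, π)`, the angular range of polar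
  -- coordinates.
  have h2 := hper.intervalIntegral_add_eq 0 (-Real.pi)
  rw [zero_add, show -Real.pi + 2 * Real.pi = Real.pi by ring] at h2
  rw [h2, intervalIntegral.integral_of_le (by linarith [Real.pi_pos]),
    integral_Ioc_eq_integral_Ioo, smul_eq_mul] at h
  have hk : (k.factorial : ℂ) ≠ 0 := by exact_mod_cast k.factorial_ne_zero
  have hI := Complex.I_ne_zero
  field_simp at h ⊢
  linear_combination h

theorem integral_gaussMeasure (g : ℂ → ℂ) :
    ∫ z, g z ∂gaussMeasure = ∫ z, (Real.exp (-‖z‖ ^ 2) / Real.pi) • g z := by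
  rw [gaussMeasure, integral_withDensity_eq_integral_toReal_smul (by fun_prop)
    (Eventually.of_forall fun z => ENNReal.ofReal_lt_top)]
  congr 1
  ext z
  rw [ENNReal.toReal_ofReal (by positivity)]

theorem integrable_gaussMeasure_iff {E : Type*} [NormedAddCommGroup E] [NormedSpace ℝ E]
    {g : ℂ → E} :
    Integrable g gaussMeasure ↔
      Integrable (fun z : ℂ => (Real.exp (-‖z‖ ^ 2) / Real.pi) • g z) volume := by
  rw [gaussMeasure, integrable_withDensity_iff_integrable_smul' (by fun_prop)
    (Eventually.of_forall fun z => ENNReal.ofReal_lt_top)]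
  refine integrable_congr (Eventually.of_forall fun z => ?_)
  simp only
  rw [ENNReal.toReal_ofReal (by positivity)]

theorem memLp_pow (k : ℕ) : MemLp (fun z : ℂ => z ^ k) 2 gaussMeasure := by
  rw [memLp_two_iff_integrable_sq_norm (by fun_prop), integrable_gaussMeasure_iff]
  have h := Complex.integral_rpow_mul_exp_neg_rpow (p := 2) (q := (2 * k : ℕ)) (by norm_num)
    (by have : (0 : ℝ) ≤ (2 * k : ℕ) := Nat.cast_nonneg _
        linarith)
  -- A nonzero value certifies integrability, because the integral of a nonintegrable function is
  -- zero by convention.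
  have hne : ∫ x : ℂ, ‖x‖ ^ ((2 * k : ℕ) : ℝ) * Real.exp (-‖x‖ ^ (2 : ℝ)) ≠ 0 := by
    rw [h]
    have := Real.Gamma_pos_of_pos (s := ((2 * k : ℕ) + 2) / 2) (by positivity)
    have := Real.pi_pos
    positivity
  refine ((Integrable.of_integral_ne_zero hne).const_mul Real.pi⁻¹).congr
    (Eventually.of_forall fun z => ?_)
  simp only [Real.rpow_natCast, Real.rpow_ofNat, norm_pow, smul_eq_mul]
  ring

theorem integrableOn_polarCoord_target {f : ℂ → ℂ} (hf : Continuous f) (hi : Integrable f) :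
    IntegrableOn (fun p : ℝ × ℝ => p.1 • f (Complex.polarCoord.symm p)) polarCoord.target := by
  have hcont : Continuous fun p : ℝ × ℝ => p.1 • f (Complex.polarCoord.symm p) := by
    simp only [Complex.polarCoord_symm_apply]
    fun_prop
  refine ⟨hcont.aestronglyMeasurable, ?_⟩
  have h := Complex.lintegral_comp_polarCoord_symm (fun z => ‖f z‖ₑ)
  rw [HasFiniteIntegral]
  refine lt_of_eq_of_lt ?_ (lt_of_eq_of_lt h hi.2)
  refine setLIntegral_congr_fun polarCoord.open_target.measurableSet fun p hp => ?_
  have : 0 < p.1 := hp.1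
  simp only [enorm_smul, smul_eq_mul]
  rw [Real.enorm_of_nonneg this.le]

/-- The angular integral isolates the `k`-th Taylor coefficient; the remaining radial integral of `r
^ (2k+1) exp(-r ^ 2)` is `k! / 2`. Fubini applies since both factors are in `L²`. -/
theorem integral_conj_pow_mul {f : ℂ → ℂ} (hf : Differentiable ℂ f)
    (hL : MemLp f 2 gaussMeasure) (k : ℕ) :
    ∫ z, conj z ^ k * f z ∂gaussMeasure = iteratedDeriv k f 0 := by
  have hfc := hf.continuous
  have hi : Integrable (fun z => conj z ^ k * f z) gaussMeasure := by
    have h1 : MemLp (fun z : ℂ => conj z ^ k) 2 gaussMeasure :=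
      (memLp_pow k).of_le (by fun_prop) (Eventually.of_forall fun z => by simp)
    exact h1.integrable_mul hL
  rw [integrable_gaussMeasure_iff] at hi
  rw [integral_gaussMeasure, ← Complex.integral_comp_polarCoord_symm]
  have hon := integrableOn_polarCoord_target (by fun_prop) hi
  rw [polarCoord_target, Measure.volume_eq_prod] at hon ⊢
  rw [setIntegral_prod _ hon]
  have hinner : ∀ r ∈ Set.Ioi (0 : ℝ), (∫ θ in Set.Ioo (-Real.pi) Real.pi,
      r • ((Real.exp (-‖Complex.polarCoord.symm (r, θ)‖ ^ 2) / Real.pi) •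
        (conj (Complex.polarCoord.symm (r, θ)) ^ k * f (Complex.polarCoord.symm (r, θ))))) =
      ((r ^ ((2 * k + 1 : ℕ) : ℝ) * Real.exp (-r ^ (2 : ℝ)) : ℝ) : ℂ) *
        (2 / k.factorial * iteratedDeriv k f 0) := by
    intro r hr
    have hr' : (0 : ℝ) < r := hr
    have hcm : ∀ θ : ℝ, Complex.polarCoord.symm (r, θ) = circleMap 0 r θ := fun θ => by
      rw [Complex.polarCoord_symm_apply, circleMap, Complex.exp_mul_I]
      simp
    simp_rw [hcm, norm_circleMap_zero]
    rw [integral_smul, integral_smul, integral_conj_pow_mul_circleMap hf k hr']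
    have hpi : (Real.pi : ℂ) ≠ 0 := by exact_mod_cast Real.pi_ne_zero
    rw [Real.rpow_natCast, Real.rpow_ofNat, sq_abs, Complex.real_smul, Complex.real_smul]
    push_cast
    field_simp
    ring
  rw [setIntegral_congr_fun measurableSet_Ioi hinner, integral_mul_const, integral_complex_ofReal,
    integral_rpow_mul_exp_neg_rpow (by norm_num)
      (by have : (0 : ℝ) ≤ (2 * k + 1 : ℕ) := Nat.cast_nonneg _
          linarith)]
  rw [show (((2 * k + 1 : ℕ) : ℝ) + 1) / 2 = (k : ℝ) + 1 by push_cast; ring, Real.Gamma_nat_eq_factorial]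
  have hk : (k.factorial : ℂ) ≠ 0 := by exact_mod_cast k.factorial_ne_zero
  push_cast
  field_simp

end Gaussian

/-! ### Orthonormality, Taylor expansion and completeness of Bargmann space -/

namespace Bargmann

/-- The entire function `z ↦ z ^ k`. -/
def monomial (k : ℕ) : entire := ⟨fun z => z ^ k, differentiable_pow k⟩

/-- The element `e_k` of Bargmann space. -/
def basisVec (k : ℕ) : Bargmann :=
  ⟨((Real.sqrt (k.factorial : ℝ) : ℂ))⁻¹ • monomial k, MemLp.const_smul (memLp_pow k) _⟩

theorem sqrt_factorial_ne_zero (k : ℕ) : ((Real.sqrt (k.factorial : ℝ) : ℂ)) ≠ 0 := by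
  have : 0 < Real.sqrt (k.factorial : ℝ) := by positivity
  exact_mod_cast this.ne'

theorem sqrt_factorial_sq (k : ℕ) : ((Real.sqrt (k.factorial : ℝ) : ℂ)) ^ 2 = k.factorial := by
  rw [← Complex.ofReal_pow, Real.sq_sqrt (by positivity), Complex.ofReal_natCast]

theorem toEntire_basisVec (k : ℕ) :
    toEntire (basisVec k) = ((Real.sqrt (k.factorial : ℝ) : ℂ))⁻¹ • monomial k := rfl

theorem coe_basisVec (k : ℕ) : (basisVec k : ℂ → ℂ) = bargmannBasisFun k := by
  funext z
  rw [bargmannBasisFun, div_eq_inv_mul]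
  rfl

theorem basisVec_apply (k : ℕ) (z : ℂ) :
    (basisVec k : ℂ → ℂ) z = z ^ k / (Real.sqrt (k.factorial : ℝ) : ℂ) := by
  rw [coe_basisVec, bargmannBasisFun]

theorem differentiable (φ : Bargmann) : Differentiable ℂ (φ : ℂ → ℂ) := (toEntire φ).2

theorem inner_basisVec (k : ℕ) (φ : Bargmann) :
    ⟪basisVec k, φ⟫_ℂ = iteratedDeriv k (φ : ℂ → ℂ) 0 / (Real.sqrt (k.factorial : ℝ) : ℂ) := by
  rw [inner_eq_integral, ← integral_conj_pow_mul φ.differentiable φ.2, ← integral_div]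
  congr 1
  ext z
  rw [basisVec_apply, map_div₀, map_pow, Complex.conj_ofReal]
  ring

theorem orthonormal_basisVec : Orthonormal ℂ basisVec := by
  rw [orthonormal_iff_ite]
  intro j k
  have h : (basisVec k : ℂ → ℂ) = fun z => ((Real.sqrt (k.factorial : ℝ) : ℂ))⁻¹ * z ^ k := rfl
  rw [inner_basisVec, h, iteratedDeriv_const_mul_field, iteratedDeriv_fun_pow_zero]
  split_ifs with hjk
  · subst hjk
    have := sqrt_factorial_ne_zero j
    rw [← sqrt_factorial_sq]
    field_simp
  · simp

/-- The expansion is the Taylor series at the origin, hence converges pointwise; so a function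
orthogonal to all `e_k` vanishes identically. -/
theorem hasSum_basisVec (φ : Bargmann) (z : ℂ) :
    HasSum (fun k => ⟪basisVec k, φ⟫_ℂ * (basisVec k : ℂ → ℂ) z) ((φ : ℂ → ℂ) z) := by
  refine (Complex.hasSum_taylorSeries_of_entire φ.differentiable 0 z).congr_fun fun k => ?_
  have := sqrt_factorial_ne_zero k
  rw [inner_basisVec, basisVec_apply, sub_zero, smul_eq_mul, smul_eq_mul, ← sqrt_factorial_sq]
  field_simp

theorem eq_zero_of_inner_basisVec {φ : Bargmann} (h : ∀ k, ⟪basisVec k, φ⟫_ℂ = 0) : φ = 0 := by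
  refine toEntire_injective (Subtype.ext (funext fun z => ?_))
  refine (hasSum_basisVec φ z).unique ?_
  simp only [h, zero_mul]
  exact hasSum_zero

/-- The evaluation functionals of Bargmann space are bounded. -/
theorem norm_apply_le (φ : Bargmann) (z : ℂ) :
    ‖(φ : ℂ → ℂ) z‖ ≤ ‖φ‖ * Real.sqrt (Real.exp (‖z‖ ^ 2)) := by
  refine le_of_tendsto (hasSum_basisVec φ z).tendsto_sum_nat.norm (Eventually.of_forall fun n => ?_)
  refine (norm_sum_le _ _).trans ?_
  refine (sq_le_sq₀ (Finset.sum_nonneg fun _ _ => norm_nonneg _) (by positivity)).1 ?_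
  simp only [norm_mul]
  -- Cauchy–Schwarz splits the sum: Bessel's inequality bounds the coefficients, and the exponential
  -- series bounds the sum of `‖e_k(z)‖ ^ 2`.
  refine (Finset.sum_mul_sq_le_sq_mul_sq _ _ _).trans ?_
  rw [mul_pow, Real.sq_sqrt (by positivity)]
  refine mul_le_mul (orthonormal_basisVec.sum_inner_products_le φ) ?_
    (Finset.sum_nonneg fun _ _ => by positivity) (by positivity)
  refine le_trans (le_of_eq (Finset.sum_congr rfl fun k _ => ?_))
    (Real.sum_le_exp_of_nonneg (sq_nonneg ‖z‖) n)
  rw [basisVec_apply, norm_div, norm_pow, Complex.norm_real, div_pow, Real.norm_of_nonneg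
    (by positivity), Real.sq_sqrt (by positivity), ← pow_mul, ← pow_mul, mul_comm]

theorem norm_toL2 (φ : Bargmann) : ‖toL2 φ‖ = ‖φ‖ := rfl

/-- By the bound on evaluations, a Cauchy sequence converges locally uniformly, so its pointwise
limit is entire. A subsequence converges almost everywhere to the `L²` limit, which identifies the
two limits. -/
instance : CompleteSpace Bargmann := by
  refine Metric.complete_of_cauchySeq_tendsto fun φ hφ => ?_
  have hiso : Isometry toL2 := AddMonoidHomClass.isometry_of_norm toL2 norm_toL2
  obtain ⟨g, hg⟩ := cauchySeq_tendsto_of_complete (hiso.uniformContinuous.comp_cauchySeq hφ)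
  have hunif : ∀ K, IsCompact K → UniformCauchySeqOn (fun n => (φ n : ℂ → ℂ)) atTop K := by
    intro K hK
    obtain ⟨R, hR⟩ := hK.isBounded.exists_norm_le
    rw [Metric.uniformCauchySeqOn_iff]
    intro ε hε
    have hC : 0 < Real.sqrt (Real.exp (R ^ 2)) := by positivity
    obtain ⟨N, hN⟩ := Metric.cauchySeq_iff.1 hφ (ε / Real.sqrt (Real.exp (R ^ 2))) (by positivity)
    refine ⟨N, fun k hk n hn z hz => ?_⟩
    have h1 := hN k hk n hn
    rw [dist_eq_norm, lt_div_iff₀ hC] at h1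
    have h2 : (φ k : ℂ → ℂ) z - (φ n : ℂ → ℂ) z = ((φ k - φ n : Bargmann) : ℂ → ℂ) z := rfl
    rw [dist_eq_norm, h2]
    refine ((norm_apply_le _ z).trans (mul_le_mul_of_nonneg_left ?_ (norm_nonneg _))).trans_lt h1
    have := hR z hz
    gcongr
  have hpt : ∀ z, ∃ w, Tendsto (fun n => (φ n : ℂ → ℂ) z) atTop (𝓝 w) := fun z =>
    cauchySeq_tendsto_of_complete ((hunif {z} isCompact_singleton).cauchySeq (by simp))
  choose F hF using hpt
  have hlim : TendstoLocallyUniformlyOn (fun n => (φ n : ℂ → ℂ)) F atTop Set.univ :=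
    (tendstoLocallyUniformlyOn_iff_forall_isCompact isOpen_univ).2 fun K _ hK =>
      (hunif K hK).tendstoUniformlyOn_of_tendsto fun z _ => hF z
  have hdiff : Differentiable ℂ F := differentiableOn_univ.1 <|
    hlim.differentiableOn (Eventually.of_forall fun n => (φ n).differentiable.differentiableOn)
      isOpen_univ
  obtain ⟨ns, hns, hae⟩ := (tendstoInMeasure_of_tendsto_Lp hg).exists_seq_tendsto_ae
  have hcoe : ∀ᵐ z ∂gaussMeasure, ∀ n, (toL2 (φ n) : ℂ → ℂ) z = (φ n : ℂ → ℂ) z :=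
    ae_all_iff.2 fun n => MemLp.coeFn_toLp (φ n).2
  have hgF : (g : ℂ → ℂ) =ᵐ[gaussMeasure] F := by
    filter_upwards [hae, hcoe] with z h1 h2
    refine tendsto_nhds_unique h1 (((hF z).comp hns.tendsto_atTop).congr fun n => ?_)
    exact (h2 (ns n)).symm
  have hFL : MemLp F 2 gaussMeasure := (memLp_congr_ae hgF).1 (Lp.memLp g)
  obtain ⟨Φ, hΦ⟩ : ∃ Φ : Bargmann, (Φ : ℂ → ℂ) = F :=
    ⟨(⟨⟨F, hdiff⟩, hFL⟩ : bargmannSubmodule), rfl⟩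
  refine ⟨Φ, hiso.isEmbedding.tendsto_nhds_iff.2 ?_⟩
  have hΦg : toL2 Φ = g := Lp.ext ((MemLp.coeFn_toLp Φ.2).trans (hΦ ▸ hgF.symm))
  rwa [hΦg]

/-- The orthonormal basis `e_k` of Bargmann space. -/
def basis : HilbertBasis ℕ ℂ Bargmann :=
  HilbertBasis.mkOfOrthogonalEqBot orthonormal_basisVec <| by
    rw [Submodule.eq_bot_iff]
    intro φ hφ
    rw [Submodule.mem_orthogonal] at hφ
    exact eq_zero_of_inner_basisVec fun k => hφ _ (Submodule.subset_span ⟨k, rfl⟩)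

theorem coe_basis : (basis : ℕ → Bargmann) = basisVec :=
  HilbertBasis.coe_mkOfOrthogonalEqBot _ _

end Bargmann

/-! ## The Heun operator on the basis -/

namespace Bargmann

theorem annihilation_pow_apply (n : ℕ) (f : entire) :
    ((annihilation ^ n) f).1 = iteratedDeriv n f.1 := by
  induction n with
  | zero => simp
  | succ n ih =>
    rw [pow_succ', iteratedDeriv_succ, ← ih]
    rfl

theorem creation_pow_apply (n : ℕ) (f : entire) (z : ℂ) :
    ((creation ^ n) f).1 z = z ^ n * f.1 z := by
  induction n with
  | zero => simp
  | succ n ih =>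
    rw [pow_succ', pow_succ', mul_assoc, ← ih]
    rfl

theorem annihilation_pow_monomial (n k : ℕ) :
    (annihilation ^ n) (monomial k) = (k.descFactorial n : ℂ) • monomial (k - n) := by
  refine Subtype.ext ?_
  rw [annihilation_pow_apply]
  funext z
  exact iteratedDeriv_pow k n

theorem creation_pow_monomial (n k : ℕ) : (creation ^ n) (monomial k) = monomial (k + n) := by
  refine Subtype.ext (funext fun z => ?_)
  rw [creation_pow_apply]
  change z ^ n * z ^ k = z ^ (k + n)
  ring

theorem heunExpr_monomial (p m k : ℕ) : heunExpr p m (monomial k) =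
    (k.descFactorial p : ℂ) • (((k - p).descFactorial m : ℂ) • monomial (k - p - m + p) +
      monomial (k - p + m + p)) := by
  simp only [heunExpr, Module.End.mul_apply, annihilation_pow_monomial, map_smul,
    LinearMap.add_apply, map_add, creation_pow_monomial]

theorem mem_graph_heunMax_iff {p m : ℕ} {φ ψ : Bargmann} :
    (φ, ψ) ∈ (heunMax p m).graph ↔ heunExpr p m (toEntire φ) = toEntire ψ := by
  have key : ∀ φ : (heunMax p m).domain,
      toEntire (heunMax p m φ) = heunExpr p m (toEntire φ) := by
    intro φ
    have h : (LinearEquiv.ofInjective toEntire toEntire_injective) (heunMax p m φ) =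
        ⟨heunExpr p m (toEntire φ), φ.2⟩ :=
      (LinearEquiv.ofInjective toEntire toEntire_injective).apply_symm_apply _
    exact congrArg Subtype.val h
  rw [LinearPMap.mem_graph_iff]
  constructor
  · rintro ⟨y, rfl, rfl⟩
    exact (key y).symm
  · intro h
    exact ⟨⟨φ, ⟨ψ, h.symm⟩⟩, rfl, toEntire_injective ((key _).trans h)⟩

theorem sqrt_inv_mul_descFactorial (p m r : ℕ) :
    ((Real.sqrt ((p + r).factorial : ℝ) : ℂ))⁻¹ * ((p + r).descFactorial p : ℂ) =
      (heunWeight p m (p + r) : ℂ) * ((Real.sqrt ((p + r + m).factorial : ℝ) : ℂ))⁻¹ := by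
  have h : r.factorial * (p + r).descFactorial p = (p + r).factorial := by
    simpa using Nat.factorial_mul_descFactorial (Nat.le_add_right p r)
  have h' : (r.factorial : ℂ) * ((p + r).descFactorial p : ℂ) =
      (Real.sqrt ((p + r).factorial : ℝ) : ℂ) ^ 2 := by
    rw [sqrt_factorial_sq]
    exact_mod_cast h
  have h0 := sqrt_factorial_ne_zero (p + r)
  have h1 := sqrt_factorial_ne_zero (p + r + m)
  have hr : (r.factorial : ℂ) ≠ 0 := by exact_mod_cast r.factorial_ne_zero
  rw [heunWeight_add, Real.sqrt_mul (by positivity)]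
  push_cast
  field_simp
  linear_combination h'

theorem heunMax_basisVec_lt {p k : ℕ} (m : ℕ) (h : k < p) :
    (basisVec k, 0) ∈ (heunMax p m).graph := by
  rw [mem_graph_heunMax_iff, toEntire_basisVec, map_smul, heunExpr_monomial,
    Nat.descFactorial_eq_zero_iff_lt.2 h]
  simp

/-- For `r < m` the power `a^(p+m)` annihilates `e_{p+r}`, so the first block has no left neighbour.
-/
theorem heunMax_basisVec_first {p m r : ℕ} (h : r < m) :
    (basisVec (p + r), (heunWeight p m (p + r) : ℂ) • basisVec (p + r + m)) ∈
      (heunMax p m).graph := by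
  rw [mem_graph_heunMax_iff, map_smul, toEntire_basisVec, toEntire_basisVec, map_smul,
    heunExpr_monomial, Nat.add_sub_cancel_left, Nat.descFactorial_eq_zero_iff_lt.2 h,
    smul_smul, smul_smul, sqrt_inv_mul_descFactorial p m r]
  simp only [Nat.cast_zero, zero_smul, zero_add]
  congr 2
  ring

theorem heunMax_basisVec_add (p m r : ℕ) :
    (basisVec (p + (r + m)), (heunWeight p m (p + (r + m)) : ℂ) • basisVec (p + (r + m) + m) +
      (heunWeight p m (p + r) : ℂ) • basisVec (p + r)) ∈ (heunMax p m).graph := by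
  rw [mem_graph_heunMax_iff, map_add, map_smul, map_smul, toEntire_basisVec, toEntire_basisVec,
    toEntire_basisVec, map_smul, heunExpr_monomial, Nat.add_sub_cancel_left, smul_smul, smul_add,
    smul_smul, smul_smul, smul_smul, sqrt_inv_mul_descFactorial p m (r + m), add_comm]
  rw [show r + m + m + p = p + (r + m) + m by ring, show r + m - m + p = p + r by omega]
  congr 2
  have h : r.factorial * (r + m).descFactorial m = (r + m).factorial := by
    simpa using Nat.factorial_mul_descFactorial (Nat.le_add_left m r)
  have h' : (r.factorial : ℂ) * ((r + m).descFactorial m : ℂ) = ((r + m).factorial : ℂ) := by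
    exact_mod_cast h
  have h0 := sqrt_factorial_ne_zero (p + r)
  have h1 := sqrt_factorial_ne_zero (p + (r + m))
  have h2 := sqrt_factorial_ne_zero (p + (r + m) + m)
  have hr : (r.factorial : ℂ) ≠ 0 := by exact_mod_cast r.factorial_ne_zero
  have hrm : ((r + m).factorial : ℂ) ≠ 0 := by exact_mod_cast (r + m).factorial_ne_zero
  rw [heunWeight_add, heunWeight_add, Real.sqrt_mul (by positivity), Real.sqrt_mul (by positivity),
    show p + r + m = p + (r + m) by ring]
  push_cast
  field_simp
  linear_combination h'

theorem bargmannPolynomials_eq : bargmannPolynomials = Submodule.span ℂ (Set.range basisVec) := by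
  have : {φ : Bargmann | ∃ k : ℕ, (φ : ℂ → ℂ) = bargmannBasisFun k} = Set.range basisVec := by
    ext φ
    refine exists_congr fun k => ?_
    rw [← coe_basisVec]
    exact ⟨fun h => (toEntire_injective (Subtype.ext h)).symm, fun h => h ▸ rfl⟩
  rw [bargmannPolynomials, this]

theorem mem_graph_heunPoly_iff {p m : ℕ} {φ ψ : Bargmann} :
    (φ, ψ) ∈ (heunPoly p m).graph ↔
      φ ∈ Submodule.span ℂ (Set.range basisVec) ∧ (φ, ψ) ∈ (heunMax p m).graph := by
  rw [← bargmannPolynomials_eq, LinearPMap.mem_graph_iff, LinearPMap.mem_graph_iff]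
  constructor
  · rintro ⟨y, rfl, rfl⟩
    exact ⟨y.2.1, ⟨y, y.2.2⟩, rfl, rfl⟩
  · rintro ⟨h, y, rfl, rfl⟩
    exact ⟨⟨y, h, y.2⟩, rfl, rfl⟩

theorem basisVec_mem_heunPoly {p m k : ℕ} {ψ : Bargmann}
    (h : (basisVec k, ψ) ∈ (heunMax p m).graph) : (basisVec k, ψ) ∈ (heunPoly p m).graph :=
  mem_graph_heunPoly_iff.2 ⟨Submodule.subset_span ⟨k, rfl⟩, h⟩

end Bargmann

/-- The index of the `j`-th basis vector in the `i`-th block. -/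
def blockIndex (p m : ℕ) (q : ℕ × Fin m) : ℕ := p + m * q.1 + q.2

theorem blockIndex_injective (p m : ℕ) : Function.Injective (blockIndex p m) := by
  rintro ⟨i, j⟩ ⟨i', j'⟩ h
  simp only [blockIndex, add_assoc, Nat.add_left_cancel_iff] at h
  have hj := j.2
  have hj' := j'.2
  have h1 := congrArg (· / m) h
  have h2 := congrArg (· % m) h
  simp only [Nat.mul_add_div (by omega : 0 < m), Nat.div_eq_of_lt hj, Nat.div_eq_of_lt hj',
    Nat.mul_add_mod, Nat.mod_eq_of_lt hj, Nat.mod_eq_of_lt hj', add_zero] at h1 h2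
  exact Prod.ext h1 (Fin.ext h2)

theorem exists_blockIndex_eq {m : ℕ} (hm : 1 ≤ m) (p r : ℕ) : ∃ q, blockIndex p m q = p + r :=
  ⟨(r / m, ⟨r % m, Nat.mod_lt _ hm⟩), by
    simp only [blockIndex, add_assoc]
    rw [Nat.div_add_mod]⟩

/-- The weights of the Heun operator, arranged in blocks. -/
def blockWeight (p m : ℕ) (i : ℕ) (j : Fin m) : ℝ := heunWeight p m (p + m * i + j)

/-! ### The block form of the Heun operator on the polynomials -/

namespace Bargmann

theorem heunPoly_zero_mem (p m : ℕ) (j : Fin m) : (basisVec (blockIndex p m (0, j)),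
    (blockWeight p m 0 j : ℂ) • basisVec (blockIndex p m (1, j))) ∈ (heunPoly p m).graph := by
  refine basisVec_mem_heunPoly ?_
  have := heunMax_basisVec_first (p := p) j.2
  simpa only [blockIndex, blockWeight, mul_zero, mul_one, add_zero, add_right_comm p m] using this

theorem heunPoly_succ_mem (p m n : ℕ) (j : Fin m) : (basisVec (blockIndex p m (n + 1, j)),
    (blockWeight p m (n + 1) j : ℂ) • basisVec (blockIndex p m (n + 2, j)) +
      (blockWeight p m n j : ℂ) • basisVec (blockIndex p m (n, j))) ∈ (heunPoly p m).graph := by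
  refine basisVec_mem_heunPoly ?_
  have := heunMax_basisVec_add p m (m * n + j)
  simp only [blockIndex, blockWeight]
  rw [show p + m * (n + 1) + (j : ℕ) = p + (m * n + j + m) by ring,
    show p + m * (n + 2) + (j : ℕ) = p + (m * n + j + m) + m by ring, add_assoc p (m * n)]
  exact this

theorem isBlockJacobi_heunPoly {p m : ℕ} (hm : 1 ≤ m) :
    IsBlockJacobi basisVec (blockIndex p m) (blockWeight p m) (heunPoly p m) where
  domain_eq := by
    refine le_antisymm ?_ (Submodule.span_le.2 ?_)
    · intro φ hφ
      obtain ⟨ψ, hψ⟩ := LinearPMap.mem_domain_iff.1 hφ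
      exact (mem_graph_heunPoly_iff.1 hψ).1
    · rintro _ ⟨k, rfl⟩
      rcases lt_or_ge k p with hk | hk
      · exact LinearPMap.mem_domain_of_mem_graph (basisVec_mem_heunPoly (heunMax_basisVec_lt m hk))
      · obtain ⟨r, rfl⟩ := Nat.exists_eq_add_of_le hk
        obtain ⟨⟨n, j⟩, hq⟩ := exists_blockIndex_eq hm p r
        rw [← hq]
        cases n with
        | zero => exact LinearPMap.mem_domain_of_mem_graph (heunPoly_zero_mem p m j)
        | succ n => exact LinearPMap.mem_domain_of_mem_graph (heunPoly_succ_mem p m n j)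
  zero_mem := heunPoly_zero_mem p m
  succ_mem := heunPoly_succ_mem p m
  other_mem k hk := by
    refine basisVec_mem_heunPoly (heunMax_basisVec_lt m ?_)
    by_contra! h
    obtain ⟨r, rfl⟩ := Nat.exists_eq_add_of_le h
    exact hk (exists_blockIndex_eq hm p r)

/-! ### The subspace spanned by `e_p, e_{p+1}, …` -/

theorem mem_bargmannVanishing_iff {p : ℕ} {φ : Bargmann} :
    φ ∈ bargmannVanishing p ↔ ∀ j < p, ⟪basisVec j, φ⟫_ℂ = 0 := by
  refine forall₂_congr fun j _ => ?_
  rw [annihilation_pow_apply, inner_basisVec, div_eq_zero_iff, or_iff_left (sqrt_factorial_ne_zero j)]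

instance (p : ℕ) : CompleteSpace (bargmannVanishing p) := by
  have hset : (bargmannVanishing p : Set Bargmann) =
      ⋂ j, ⋂ (_ : j < p), {φ | ⟪basisVec j, φ⟫_ℂ = 0} := by
    ext φ
    simp [mem_bargmannVanishing_iff]
  have hcl : IsClosed (bargmannVanishing p : Set Bargmann) := by
    rw [hset]
    exact isClosed_iInter fun j => isClosed_iInter fun _ => isClosed_eq (by fun_prop) (by fun_prop)
  exact hcl.completeSpace_coe

theorem basisVec_mem_bargmannVanishing (p r : ℕ) : basisVec (p + r) ∈ bargmannVanishing p :=
  mem_bargmannVanishing_iff.2 fun j hj => orthonormal_basisVec.2 (by omega)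

theorem basisVec_blockIndex_mem (p m : ℕ) (q : ℕ × Fin m) :
    basisVec (blockIndex p m q) ∈ bargmannVanishing p := by
  rw [blockIndex, add_assoc]
  exact basisVec_mem_bargmannVanishing p _

/-- The basis vectors `e_p, e_{p+1}, …`, cut into blocks. -/
def blockVec (p m : ℕ) (q : ℕ × Fin m) : bargmannVanishing p :=
  ⟨basisVec (blockIndex p m q), basisVec_blockIndex_mem p m q⟩

theorem orthonormal_blockVec (p m : ℕ) : Orthonormal ℂ (blockVec p m) := by
  have h := orthonormal_basisVec.comp _ (blockIndex_injective p m)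
  exact ⟨fun q => h.1 q, fun _ _ hq => h.2 hq⟩

theorem eq_zero_of_inner_blockVec {p m : ℕ} (hm : 1 ≤ m) {φ : Bargmann}
    (hφ : φ ∈ bargmannVanishing p) (h : ∀ q, ⟪basisVec (blockIndex p m q), φ⟫_ℂ = 0) : φ = 0 := by
  refine eq_zero_of_inner_basisVec fun k => ?_
  rcases lt_or_ge k p with hk | hk
  · exact mem_bargmannVanishing_iff.1 hφ k hk
  · obtain ⟨r, rfl⟩ := Nat.exists_eq_add_of_le hk
    obtain ⟨q, hq⟩ := exists_blockIndex_eq hm p r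
    rw [← hq]
    exact h q

/-- The orthonormal basis `e_p, e_{p+1}, …`, cut into blocks. -/
def blockBasis (p : ℕ) {m : ℕ} (hm : 1 ≤ m) : HilbertBasis (ℕ × Fin m) ℂ (bargmannVanishing p) :=
  HilbertBasis.mkOfOrthogonalEqBot (orthonormal_blockVec p m) <| by
    rw [Submodule.eq_bot_iff]
    intro φ hφ
    rw [Submodule.mem_orthogonal] at hφ
    have h : (φ : Bargmann) = 0 := eq_zero_of_inner_blockVec hm φ.2 fun q => by
      have := hφ (blockVec p m q) (Submodule.subset_span ⟨q, rfl⟩)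
      rwa [Submodule.coe_inner] at this
    exact Subtype.ext h

theorem coe_blockBasis (p : ℕ) {m : ℕ} (hm : 1 ≤ m) : ⇑(blockBasis p hm) = blockVec p m :=
  HilbertBasis.coe_mkOfOrthogonalEqBot _ _

theorem mem_graph_partOn_iff {E : Type*} [AddCommGroup E] [Module ℂ E] {T : E →ₗ.[ℂ] E}
    {V : Submodule ℂ E} {v w : V} :
    (v, w) ∈ (partOn T V).graph ↔ ((v : E), (w : E)) ∈ T.graph := by
  rw [LinearPMap.mem_graph_iff, LinearPMap.mem_graph_iff]
  constructor
  · rintro ⟨y, rfl, rfl⟩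
    exact ⟨⟨y.1, y.2.1⟩, rfl, rfl⟩
  · rintro ⟨⟨y, hy⟩, rfl, h⟩
    exact ⟨⟨v, hy, by rw [h]; exact w.2⟩, rfl, Subtype.ext h⟩

/-- Split off the part spanned by the `e_k` with `k < p`. It lies in the vanishing subspace, being a
difference of two of its elements, and is orthogonal to all later `e_k`, hence is zero. -/
theorem mem_span_blockVec {p m : ℕ} (hm : 1 ≤ m) {φ : bargmannVanishing p}
    (hφ : (φ : Bargmann) ∈ Submodule.span ℂ (Set.range basisVec)) :
    φ ∈ Submodule.span ℂ (Set.range (blockVec p m)) := by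
  have hle : Submodule.span ℂ (Set.range basisVec) ≤
      (Submodule.span ℂ (Set.range (blockVec p m))).map (bargmannVanishing p).subtype ⊔
        Submodule.span ℂ (basisVec '' Set.Iio p) := by
    refine Submodule.span_le.2 ?_
    rintro _ ⟨k, rfl⟩
    rcases lt_or_ge k p with hk | hk
    · exact Submodule.mem_sup_right (Submodule.subset_span ⟨k, hk, rfl⟩)
    · obtain ⟨r, rfl⟩ := Nat.exists_eq_add_of_le hk
      obtain ⟨q, hq⟩ := exists_blockIndex_eq hm p r
      rw [← hq]
      exact Submodule.mem_sup_left ⟨blockVec p m q, Submodule.subset_span ⟨q, rfl⟩, rfl⟩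
  obtain ⟨_, ⟨ψ, hψ, rfl⟩, χ, hχ, hsum⟩ := Submodule.mem_sup.1 (hle hφ)
  have hχV : χ ∈ bargmannVanishing p := by
    rw [eq_sub_iff_add_eq'.2 hsum]
    exact (bargmannVanishing p).sub_mem φ.2 ψ.2
  have hχ0 : χ = 0 := by
    refine eq_zero_of_inner_blockVec hm hχV fun q => ?_
    have hle' : Submodule.span ℂ (basisVec '' Set.Iio p) ≤
        (Submodule.span ℂ {basisVec (blockIndex p m q)})ᗮ := by
      refine Submodule.span_le.2 ?_
      rintro _ ⟨k, hk, rfl⟩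
      refine Submodule.mem_orthogonal_singleton_iff_inner_right.2 (orthonormal_basisVec.2 ?_)
      have : k < p := hk
      simp only [blockIndex]
      omega
    exact Submodule.mem_orthogonal_singleton_iff_inner_right.1 (hle' hχ)
  have : φ = ψ := Subtype.ext (by rw [← hsum, hχ0, add_zero]; rfl)
  rwa [this]

theorem isBlockJacobi_partOn_heunPoly {p m : ℕ} (hm : 1 ≤ m) :
    IsBlockJacobi (blockVec p m) id (blockWeight p m)
      (partOn (heunPoly p m) (bargmannVanishing p)) where
  domain_eq := by
    refine le_antisymm ?_ (Submodule.span_le.2 ?_)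
    · intro φ hφ
      obtain ⟨ψ, hψ⟩ := LinearPMap.mem_domain_iff.1 hφ
      exact mem_span_blockVec hm (mem_graph_heunPoly_iff.1 (mem_graph_partOn_iff.1 hψ)).1
    · rintro _ ⟨⟨n, j⟩, rfl⟩
      cases n with
      | zero =>
        exact LinearPMap.mem_domain_of_mem_graph (y := (blockWeight p m 0 j : ℂ) • blockVec p m (1, j))
          (mem_graph_partOn_iff.2 (heunPoly_zero_mem p m j))
      | succ n =>
        exact LinearPMap.mem_domain_of_mem_graph
          (y := (blockWeight p m (n + 1) j : ℂ) • blockVec p m (n + 2, j) +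
            (blockWeight p m n j : ℂ) • blockVec p m (n, j))
          (mem_graph_partOn_iff.2 (heunPoly_succ_mem p m n j))
  zero_mem j := mem_graph_partOn_iff.2 (heunPoly_zero_mem p m j)
  succ_mem n j := mem_graph_partOn_iff.2 (heunPoly_succ_mem p m n j)
  other_mem k hk := absurd ⟨k, rfl⟩ hk

end Bargmann

/-! ## The block Jacobi operator on the standard basis -/

namespace BlockSeq

/-- The standard basis vectors of `ℓ²(ℕ; ℂ^m)`. -/
def blockSingle (m : ℕ) (q : ℕ × Fin m) : BlockSeq m :=
  lp.single 2 q.1 (EuclideanSpace.single q.2 (1 : ℂ))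

theorem blockSingle_apply (m : ℕ) (q : ℕ × Fin m) (i : ℕ) (j : Fin m) :
    (blockSingle m q i) j = if i = q.1 ∧ j = q.2 then 1 else 0 := by
  rw [blockSingle, lp.single_apply, Pi.single_apply]
  split_ifs with h1 h2 h3
  · simp [h2.2]
  · have : j ≠ q.2 := fun h => h2 ⟨h1, h⟩
    simp [this]
  · exact absurd h3.1 h1
  · rfl

theorem inner_blockSingle {m : ℕ} (q : ℕ × Fin m) (x : BlockSeq m) :
    ⟪blockSingle m q, x⟫_ℂ = x q.1 q.2 := by
  rw [blockSingle, lp.inner_single_left, EuclideanSpace.inner_single_left, map_one, one_mul]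

theorem orthonormal_blockSingle (m : ℕ) : Orthonormal ℂ (blockSingle m) := by
  rw [orthonormal_iff_ite]
  intro q q'
  rw [inner_blockSingle, blockSingle_apply]
  simp only [Prod.ext_iff]

theorem smul_blockSingle_apply {m : ℕ} (c : ℂ) (q : ℕ × Fin m) (i : ℕ) (j : Fin m) :
    ((c • blockSingle m q : BlockSeq m) i) j = if i = q.1 ∧ j = q.2 then c else 0 := by
  rw [lp.coeFn_smul, Pi.smul_apply, PiLp.smul_apply, blockSingle_apply, smul_eq_mul, mul_ite,
    mul_one, mul_zero]

theorem smul_add_smul_blockSingle_apply {m : ℕ} (c d : ℂ) (q r : ℕ × Fin m) (i : ℕ) (j : Fin m) :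
    ((c • blockSingle m q + d • blockSingle m r : BlockSeq m) i) j =
      (if i = q.1 ∧ j = q.2 then c else 0) + if i = r.1 ∧ j = r.2 then d else 0 := by
  rw [lp.coeFn_add, Pi.add_apply, PiLp.add_apply, smul_blockSingle_apply, smul_blockSingle_apply]

/-- The standard basis of `ℓ²(ℕ; ℂ^m)`. -/
def basis (m : ℕ) : HilbertBasis (ℕ × Fin m) ℂ (BlockSeq m) :=
  HilbertBasis.mkOfOrthogonalEqBot (orthonormal_blockSingle m) <| by
    rw [Submodule.eq_bot_iff]
    intro x hx
    rw [Submodule.mem_orthogonal] at hx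
    refine lp.ext (funext fun i => PiLp.ext fun j => ?_)
    rw [← inner_blockSingle (i, j)]
    exact hx _ (Submodule.subset_span ⟨(i, j), rfl⟩)

theorem coe_basis (m : ℕ) : ⇑(basis m) = blockSingle m :=
  HilbertBasis.coe_mkOfOrthogonalEqBot _ _

theorem mem_span_blockSingle {m : ℕ} {x : BlockSeq m} {N : ℕ} (hN : ∀ i ≥ N, x i = 0) :
    x ∈ Submodule.span ℂ (Set.range (blockSingle m)) := by
  have hx : x = ∑ i ∈ Finset.range N, ∑ j, x i j • blockSingle m (i, j) := by
    refine lp.ext (funext fun i => PiLp.ext fun j => ?_)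
    rw [← inner_blockSingle (i, j), ← inner_blockSingle (i, j), inner_sum]
    simp only [inner_sum, inner_smul_right, inner_blockSingle, blockSingle_apply]
    by_cases hi : i < N
    · simp [ite_and, hi]
    · simp [ite_and, hi, hN i (not_lt.1 hi)]
  rw [hx]
  exact Submodule.sum_mem _ fun i _ => Submodule.sum_mem _ fun j _ =>
    Submodule.smul_mem _ _ (Submodule.subset_span ⟨(i, j), rfl⟩)

theorem mem_graph_jacobiFin_iff {m : ℕ} {A B : ℕ → Matrix (Fin m) (Fin m) ℂ} {x y : BlockSeq m} :
    (x, y) ∈ (jacobiFin A B).graph ↔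
      (∃ N : ℕ, ∀ i ≥ N, x i = 0) ∧ jacobiExpr A B (fun i => x i) = fun i => y i := by
  rw [LinearPMap.mem_graph_iff]
  constructor
  · rintro ⟨z, rfl, rfl⟩
    exact ⟨z.2.1, rfl⟩
  · rintro ⟨h, h'⟩
    exact ⟨⟨x, h, by rw [h']; exact lp.memℓp y⟩, rfl, lp.ext h'⟩

theorem heunBlock_apply (p m i : ℕ) (x : EuclideanSpace ℂ (Fin m)) (j : Fin m) :
    ((heunBlock p m i).toEuclideanLin x) j = blockWeight p m i j * x j := by
  rw [Matrix.toEuclideanLin, Matrix.toLpLin_apply]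
  simp only [heunBlock, Matrix.mulVec_diagonal]
  rfl

theorem heunBlock_conjTranspose (p m i : ℕ) : (heunBlock p m i)ᴴ = heunBlock p m i := by
  rw [heunBlock, Matrix.diagonal_conjTranspose]
  congr 1
  ext j
  simp

theorem jacobiExpr_heunBlock_zero (p m : ℕ) (x : ℕ → EuclideanSpace ℂ (Fin m)) (j : Fin m) :
    (jacobiExpr (fun _ => 0) (heunBlock p m) x 0) j = blockWeight p m 0 j * x 1 j := by
  rw [← heunBlock_apply]
  simp [jacobiExpr]

theorem jacobiExpr_heunBlock_succ (p m : ℕ) (x : ℕ → EuclideanSpace ℂ (Fin m)) (n : ℕ)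
    (j : Fin m) : (jacobiExpr (fun _ => 0) (heunBlock p m) x (n + 1)) j =
      blockWeight p m n j * x n j + blockWeight p m (n + 1) j * x (n + 2) j := by
  rw [← heunBlock_apply, ← heunBlock_apply]
  simp [jacobiExpr, heunBlock_conjTranspose]

theorem mem_graph_jacobiFin_heunBlock_iff {p m : ℕ} {x y : BlockSeq m} :
    (x, y) ∈ (jacobiFin (fun _ => 0) (heunBlock p m)).graph ↔
      (∃ N : ℕ, ∀ i ≥ N, x i = 0) ∧ (∀ j, y 0 j = blockWeight p m 0 j * x 1 j) ∧
      ∀ n j, y (n + 1) j = blockWeight p m n j * x n j + blockWeight p m (n + 1) j * x (n + 2) j := by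
  rw [mem_graph_jacobiFin_iff]
  refine and_congr_right fun _ => ⟨fun h => ⟨fun j => ?_, fun n j => ?_⟩, fun h => ?_⟩
  · rw [← jacobiExpr_heunBlock_zero p m (fun i => x i), h]
  · rw [← jacobiExpr_heunBlock_succ p m (fun i => x i), h]
  · refine funext fun i => PiLp.ext fun j => ?_
    cases i with
    | zero => rw [jacobiExpr_heunBlock_zero, h.1]
    | succ n => rw [jacobiExpr_heunBlock_succ, h.2]

theorem blockSingle_eventually_zero {m : ℕ} (q : ℕ × Fin m) :
    ∃ N : ℕ, ∀ i ≥ N, blockSingle m q i = 0 :=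
  ⟨q.1 + 1, fun i hi => PiLp.ext fun j => by
    rw [blockSingle_apply, if_neg fun h => by omega]; rfl⟩

theorem jacobiFin_zero_mem (p m : ℕ) (j : Fin m) :
    (blockSingle m (0, j), (blockWeight p m 0 j : ℂ) • blockSingle m (1, j)) ∈
      (jacobiFin (fun _ => 0) (heunBlock p m)).graph := by
  refine mem_graph_jacobiFin_heunBlock_iff.2
    ⟨blockSingle_eventually_zero _, fun j' => ?_, fun n j' => ?_⟩ <;>
    simp only [smul_blockSingle_apply, blockSingle_apply]
  · simp
  · rcases eq_or_ne j' j with rfl | hj <;> rcases eq_or_ne n 0 with rfl | hn <;>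
      simp [*]

theorem jacobiFin_succ_mem (p m n : ℕ) (j : Fin m) :
    (blockSingle m (n + 1, j), (blockWeight p m (n + 1) j : ℂ) • blockSingle m (n + 2, j) +
      (blockWeight p m n j : ℂ) • blockSingle m (n, j)) ∈
      (jacobiFin (fun _ => 0) (heunBlock p m)).graph := by
  refine mem_graph_jacobiFin_heunBlock_iff.2
    ⟨blockSingle_eventually_zero _, fun j' => ?_, fun l j' => ?_⟩ <;>
    simp only [smul_add_smul_blockSingle_apply, blockSingle_apply]
  · rcases eq_or_ne j' j with rfl | hj <;> rcases eq_or_ne n 0 with rfl | hn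
    · simp
    · simp [hn, hn.symm]
    · simp [hj]
    · simp [hj]
  · rcases eq_or_ne j' j with rfl | hj
    · rcases eq_or_ne l (n + 1) with rfl | h1
      · have : n + 1 + 1 ≠ n := by omega
        simp [this]
      · rcases eq_or_ne n (l + 1) with rfl | h2
        · have : l ≠ l + 1 + 1 := by omega
          simp [this]
        · simp [h1, h2.symm]
    · simp [hj]

/-- The same weights as for the Heun operator occur, so the generating pairs of the two graphs
correspond one to one. -/
theorem isBlockJacobi_jacobiFin (p m : ℕ) :
    IsBlockJacobi (blockSingle m) id (blockWeight p m)
      (jacobiFin (fun _ => 0) (heunBlock p m)) where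
  domain_eq := by
    refine le_antisymm ?_ (Submodule.span_le.2 ?_)
    · rintro x ⟨⟨N, hN⟩, -⟩
      exact mem_span_blockSingle hN
    · rintro _ ⟨⟨n, j⟩, rfl⟩
      cases n with
      | zero => exact LinearPMap.mem_domain_of_mem_graph (jacobiFin_zero_mem p m j)
      | succ n => exact LinearPMap.mem_domain_of_mem_graph (jacobiFin_succ_mem p m n j)
  zero_mem := jacobiFin_zero_mem p m
  succ_mem := jacobiFin_succ_mem p m
  other_mem k hk := absurd ⟨k, rfl⟩ hk

end BlockSeq

end

theorem theorem2p3 (p m : ℕ) (hm : 1 ≤ m) (hpm : (1 : ℝ) < (p : ℝ) + (m : ℝ) / 2) :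
    -- the minimal Heun operator is closed symmetric with deficiency numbers `n₊ = n₋ = m`,
    -- in the closed span of `e_p, e_{p+1}, …` and in the whole Bargmann space
    (IsClosedSymmetric (heunMin p m) ∧ IsCompletelyIndeterminate m (heunMin p m)) ∧
    (IsClosedSymmetric (heunMinFull p m) ∧ IsCompletelyIndeterminate m (heunMinFull p m)) ∧
    -- in the basis `e_p, e_{p+1}, …`, cut into blocks of length `m`, it is the minimal block
    -- Jacobi operator with zero diagonal blocks and off-diagonal blocks `heunBlock p m i`
    (∃ U : bargmannVanishing p ≃ₗᵢ[ℂ] BlockSeq m,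
      (∀ (i : ℕ) (j : Fin m),
        ((U.symm (lp.single 2 i (EuclideanSpace.single j (1 : ℂ))) : Bargmann) : ℂ → ℂ) =
          bargmannBasisFun (p + m * i + j)) ∧
      (∀ φ ψ : bargmannVanishing p,
        (φ, ψ) ∈ (heunMin p m).graph ↔
          (U φ, U ψ) ∈ (jacobiMin (fun _ => 0) (heunBlock p m)).graph)) ∧
    -- the block `heunBlock p m i` is the `(i + 1)`-st one
    (fun i : ℕ => matrixSpectralNorm (heunBlock p m i)) ~[atTop]
      (fun i : ℕ => ((m : ℝ) * ((i : ℝ) + 1)) ^ ((p : ℝ) + (m : ℝ) / 2)) := by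
  have hw : ∀ j : Fin m, IsBerezanskii fun i => blockWeight p m i j := fun j =>
    isBerezanskii_heunWeight hm hpm j
  have hfull := Bargmann.isBlockJacobi_heunPoly (p := p) hm
  rw [← Bargmann.coe_basis] at hfull
  have hpart := Bargmann.isBlockJacobi_partOn_heunPoly (p := p) hm
  rw [← Bargmann.coe_blockBasis p hm] at hpart
  have hjac := BlockSeq.isBlockJacobi_jacobiFin p m
  rw [← BlockSeq.coe_basis] at hjac
  have hinj := blockIndex_injective p m
  have hid : Function.Injective (id : ℕ × Fin m → ℕ × Fin m) := Function.injective_id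
  -- Both bases are indexed by `ℕ × Fin m`; composing the two coordinate maps matches `e_{p+mi+j}`
  -- with the `j`-th unit vector of the block `i`.
  let U : bargmannVanishing p ≃ₗᵢ[ℂ] BlockSeq m :=
    (Bargmann.blockBasis p hm).repr.trans (BlockSeq.basis m).repr.symm
  have hU : ∀ q, U (Bargmann.blockBasis p hm q) = BlockSeq.basis m q := fun q => by
    simp [U, HilbertBasis.repr_self]
  refine ⟨⟨isClosedSymmetric_closure (hpart.isFormalAdjoint
      (Bargmann.blockBasis p hm).orthonormal hid) hpart.dense_domain,
      hpart.isCompletelyIndeterminate_closure hid hw⟩,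
    ⟨isClosedSymmetric_closure (hfull.isFormalAdjoint Bargmann.basis.orthonormal hinj)
      hfull.dense_domain, hfull.isCompletelyIndeterminate_closure hinj hw⟩,
    ⟨U, fun i j => ?_, mem_graph_closure_iff_of_map (hpart.isClosable hid) (hjac.isClosable hid) U
      (hpart.mem_graph_iff_of_map hjac U hU)⟩,
    matrixSpectralNorm_heunBlock_isEquivalent hm⟩
  have h : U.symm (BlockSeq.basis m (i, j)) = Bargmann.blockBasis p hm (i, j) := by
    rw [← hU, U.symm_apply_apply]
  rw [BlockSeq.coe_basis, Bargmann.coe_blockBasis] at h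
  change ((U.symm (BlockSeq.blockSingle m (i, j)) : Bargmann) : ℂ → ℂ) = _
  rw [h]
  exact Bargmann.coe_basisVec _
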